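/- Let $n\ge 6$ and $M(n)=\{x\in[-1,1]^n:\sum_{k=1}^n x_k=0\}$, regarded as a subset of the hyperplane $\vec 1^{\perp}=\{x\in\mathbb R^n:\sum_k x_k=0\}$, which carries $(n-1)$-dimensional Lebesgue measure $v_{n-1}$. A Gerow–Robson density on $M(n)$ is a (Borel measurable) probability density $h$ on $M(n)$ with respect to $v_{n-1}$ of the form $h(x)=f(\max_k|x_k|)$ for $x\in M(n)$, for some function $f:[0,1]\to[0,\infty)$. A random balanced sample is a random vector $(X_1,\dots,X_n)$ with $\sum_k X_k=0$ such that each $X_k$ is uniformly distributed over $[-1,1]$; the density $h$ gives a random balanced sample if a random vector with density $h$ is one. Let $\alpha_n=\lfloor (n-3)/2\rfloor$. For $m\ge 3$ let $\varphi_m$ be the $(m-2)$-fold convolution of the function $\tfrac12 I_{[-1,1]}$ with itself, and put $$C_n=\frac{1}{(n-3)!\,2^{n-1}\,\varphi_{n+1}(1)}.$$ Let $c_{0,n},\dots,c_{\alpha_n,n}$ be the real coefficients for which, for all $s\in[0,1]$, $$\sum_{k=0}^{n-2}\binom{n-2}{k}(-1)^k\Big\{(n-1-2k+s)_+^{\,n-3}+(n-1-2k-s)_+^{\,n-3}\Big\}=\sum_{j=0}^{\alpha_n}c_{j,n}s^{2j},$$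 where $t_+=\max(t,0)$, and let $B_n$ be the polynomial $$B_n(s)=\Big(\prod_{j=0}^{\alpha_n}(s+2j)\Big)\Big(1+(n-1)C_n\sum_{j=0}^{\alpha_n}\frac{c_{j,n}}{s+2j}\Big).$$ Theorem. Suppose that $B_n$ has $\alpha_n+1$ distinct real roots $a_0>a_1>\dots>a_{\alpha_n}$, and let $b_0,\dots,b_{\alpha_n}$ be the real numbers in the partial fraction decomposition $$\frac{n\prod_{j=1}^{\alpha_n}(s+2j)}{B_n(s)}=\sum_{j=0}^{\alpha_n}\frac{b_j}{s-a_j}.$$ If $b_0<0$, then there is no Gerow–Robson density on $M(n)$ that gives a random balanced sample. -/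

import Mathlib

open MeasureTheory Polynomial
open scoped NNReal ENNReal

namespace RBS

noncomputable section

/-! ### Random balanced samples and Gerow–Robson densities -/

/-- A random balanced sample: random variables `X 0, …, X (n-1)` on a probability space whose sum
is (almost surely) `0`, each of them uniformly distributed over `[-1, 1]`. The uniformity clause
contains the almost everywhere measurability of each `X k`. -/
def IsRandomBalancedSample {Ω : Type*} [MeasurableSpace Ω] {n : ℕ}
    (X : Fin n → Ω → ℝ) (P : Measure Ω) : Prop :=
  (∀ᵐ ω ∂P, ∑ k, X k ω = 0) ∧
    ∀ k, pdf.IsUniform (X k) (Set.Icc (-1 : ℝ) 1) P volume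

/-- The hyperplane of all vectors of Euclidean `n`-space perpendicular to `(1, …, 1)`. -/
abbrev onePerp (n : ℕ) : Submodule ℝ (EuclideanSpace ℝ (Fin n)) :=
  (Submodule.span ℝ {(WithLp.toLp 2 fun _ => 1 : EuclideanSpace ℝ (Fin n))})ᗮ

/-- `(n-1)`-dimensional Lebesgue measure on the hyperplane, carried over from Euclidean space
by a linear isometry. (It is spelled out, since the bare `volume` of a subtype may be elaborated
as the restriction of the `n`-dimensional volume, which vanishes on a hyperplane.) -/
def perpVolume (n : ℕ) : Measure (onePerp n) :=
  (volume : Measure (EuclideanSpace ℝ (Fin (Module.finrank ℝ (onePerp n))))).map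
    (stdOrthonormalBasis ℝ (onePerp n)).repr.symm

/-- The polytope `M(n)` of all `x ∈ [-1, 1]ⁿ` with coordinate sum `0`. -/
def polytope (n : ℕ) : Set (onePerp n) :=
  {x | ∀ k, (x : EuclideanSpace ℝ (Fin n)) k ∈ Set.Icc (-1 : ℝ) 1}

/-- The maximum norm `max |x k|` (the norm of the function space `Fin n → ℝ`). -/
def maxNorm {n : ℕ} (x : onePerp n) : ℝ :=
  ‖(WithLp.ofLp (x : EuclideanSpace ℝ (Fin n)) : Fin n → ℝ)‖

/-- `h` is (on `M(n)`) a Gerow–Robson density: a probability density on `M(n)` with respect to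
`(n-1)`-dimensional volume that depends on the maximum norm only. Only the values of
`h` on `M(n)` and those of `f` on `[0, 1]` (the range of the maximum norm on `M(n)`) matter. -/
structure IsGerowRobsonDensity (n : ℕ) (h : onePerp n → ℝ≥0) : Prop where
  measurable : Measurable ((polytope n).domRestrict h)
  lintegral_eq_one : ∫⁻ x in polytope n, (h x : ℝ≥0∞) ∂(perpVolume n) = 1
  radial : ∃ f : ℝ → ℝ≥0, ∀ x ∈ polytope n, h x = f (maxNorm x)

/-- The distribution on `M(n)` with density `h`. -/
def distribution (n : ℕ) (h : onePerp n → ℝ≥0) : Measure (onePerp n) :=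
  ((perpVolume n).restrict (polytope n)).withDensity fun x => (h x : ℝ≥0∞)

/-- The density `h` gives a random balanced sample: the coordinates of a random point with
density `h` form one. -/
def GivesRandomBalancedSample (n : ℕ) (h : onePerp n → ℝ≥0) : Prop :=
  IsRandomBalancedSample (fun (k : Fin n) (x : onePerp n) => (x : EuclideanSpace ℝ (Fin n)) k)
    (distribution n h)

/-! ### The polynomial `B n` -/

/-- The uniform density over `[-1, 1]`. -/
def unifDensity : ℝ → ℝ := (Set.Icc (-1 : ℝ) 1).indicator fun _ => 1 / 2

/-- The `(m+1)`-fold convolution of the uniform density with itself. -/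
def unifConv : ℕ → ℝ → ℝ
  | 0 => unifDensity
  | m + 1 => convolution unifDensity (unifConv m) (ContinuousLinearMap.mul ℝ ℝ) volume

/-- `φ_n`: the density of the sum of `n - 2` independent uniform variables over `[-1, 1]`
(for `3 ≤ n`). -/
def phi (n : ℕ) : ℝ → ℝ := unifConv (n - 3)

/-- The normalizing constant `C_n = 1 / ((n-3)! 2^(n-1) φ_{n+1}(1))`. -/
def normConst (n : ℕ) : ℝ :=
  1 / (((n - 3).factorial : ℝ) * 2 ^ (n - 1) * phi (n + 1) 1)

/-- The polynomial that agrees for `0 ≤ s ≤ 1` with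
`∑ k, (-1)^k (n-2 choose k) ((n-1-2k+s)₊^(n-3) + (n-1-2k-s)₊^(n-3))`;
see `sum_truncated_eq` below. -/
def truncPoly (n : ℕ) : ℝ[X] :=
  ∑ k ∈ Finset.range (n - 1), C ((-1) ^ k * ((n - 2).choose k : ℝ)) *
    (if 2 * k + 1 < n then
      (C ((n : ℝ) - 1 - 2 * k) + X) ^ (n - 3) + (C ((n : ℝ) - 1 - 2 * k) - X) ^ (n - 3)
    else if 2 * k + 1 = n then X ^ (n - 3)
    else 0)

/-- The coefficient `c_{j,n}` of `s^(2j)` in that polynomial. -/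
def coeffC (n j : ℕ) : ℝ := (truncPoly n).coeff (2 * j)

/-- `α_n = ⌊(n-3)/2⌋`. -/
def alpha (n : ℕ) : ℕ := (n - 3) / 2

/-- `B_n(s) = (∏_{j=0}^{α_n} (s+2j)) (1 + (n-1) C_n ∑_{j=0}^{α_n} c_{j,n}/(s+2j))`,
multiplied out. -/
def B (n : ℕ) : ℝ[X] :=
  ∏ j ∈ Finset.range (alpha n + 1), (X + C (2 * (j : ℝ))) +
    C (((n : ℝ) - 1) * normConst n) * ∑ j ∈ Finset.range (alpha n + 1), C (coeffC n j) *
      ∏ i ∈ (Finset.range (alpha n + 1)).erase j, (X + C (2 * (i : ℝ)))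

/-- For `0 ≤ s ≤ 1` the alternating sum of truncated powers is the even polynomial
with coefficients `c_{j,n}`. -/
theorem sum_truncated_eq (n : ℕ) (hn : 4 ≤ n) (s : ℝ) (hs : s ∈ Set.Icc (0 : ℝ) 1) :
    ∑ k ∈ Finset.range (n - 1), (-1) ^ k * ((n - 2).choose k : ℝ) *
      ((max ((n : ℝ) - 1 - 2 * k + s) 0) ^ (n - 3) + (max ((n : ℝ) - 1 - 2 * k - s) 0) ^ (n - 3)) =
    ∑ j ∈ Finset.range (alpha n + 1), coeffC n j * s ^ (2 * j) := by
  obtain ⟨h0, h1⟩ := hs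
  have hz : n - 3 ≠ 0 := by omega
  have heval : ∑ k ∈ Finset.range (n - 1), (-1) ^ k * ((n - 2).choose k : ℝ) *
      ((max ((n : ℝ) - 1 - 2 * k + s) 0) ^ (n - 3) + (max ((n : ℝ) - 1 - 2 * k - s) 0) ^ (n - 3)) =
      (truncPoly n).eval s := by
    rw [truncPoly, eval_finsetSum]
    refine Finset.sum_congr rfl fun k _ => ?_
    rw [eval_mul, eval_C]
    congr 1
    split_ifs with h h'
    · have : (2 * k + 2 : ℝ) ≤ n := by exact_mod_cast h
      rw [max_eq_left (by linarith), max_eq_left (by linarith)]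
      simp
    · have : (2 * k + 1 : ℝ) = n := by exact_mod_cast h'
      rw [← this, max_eq_left (by linarith), max_eq_right (by linarith)]
      simp [hz]
    · have : (n + 1 : ℝ) ≤ 2 * k + 1 := by exact_mod_cast (by omega)
      rw [max_eq_right (by linarith), max_eq_right (by linarith)]
      simp [hz]
  have heven : (truncPoly n).comp (-X) = truncPoly n := by
    rw [truncPoly, ← coe_compRingHom_apply, map_sum]
    refine Finset.sum_congr rfl fun k _ => ?_
    rw [coe_compRingHom_apply, mul_comp, C_comp]
    congr 1
    split_ifs with h h'
    · simp [add_comm, sub_eq_add_neg]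
    · have : Even (n - 3) := ⟨k - 1, by omega⟩
      simp [this.neg_pow]
    · simp
  have hodd : ∀ j, (truncPoly n).coeff (2 * j + 1) = 0 := fun j => by
    have := congrArg (fun p => p.coeff (2 * j + 1)) heven
    rw [show (-X : ℝ[X]) = C (-1) * X by simp] at this
    simp only [comp_C_mul_X_coeff] at this
    have e : (-1 : ℝ) ^ (2 * j + 1) = -1 := by rw [pow_succ, pow_mul]; simp
    rw [e] at this
    linarith
  have hdeg : (truncPoly n).natDegree < 2 * (alpha n + 1) := by
    have : (truncPoly n).natDegree ≤ n - 3 := by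
      refine natDegree_sum_le_of_forall_le _ _ fun k _ => ?_
      refine (natDegree_C_mul_le _ _).trans ?_
      split_ifs
      · compute_degree
      · simp
      · simp
    unfold alpha
    omega
  have hpair : ∀ (f : ℕ → ℝ) (m : ℕ), ∑ i ∈ Finset.range (2 * m), f i =
      ∑ j ∈ Finset.range m, (f (2 * j) + f (2 * j + 1)) := fun f m => by
    induction m with
    | zero => simp
    | succ m ih =>
      rw [Finset.sum_range_succ, ← ih, show 2 * (m + 1) = 2 * m + 1 + 1 by ring,
        Finset.sum_range_succ, Finset.sum_range_succ]
      ring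
  rw [heval, eval_eq_sum_range' hdeg, hpair]
  exact Finset.sum_congr rfl fun j _ => by simp [hodd, coeffC]

end

end RBS

/-! Suppose such a density exists and let R be the maximum norm of a random point X with that
density. By homogeneity of the norm and of volume, X = R U with R independent of U and the law of U
the same for every radial density. Hence E|X_1|^k = E R^k · E|U_1|^k. Uniformity makes the left side
1/(k+1). For the uniform density on M(n) the radius has density proportional to r^(n-2), and X_1 has
a density on [-1, 1] proportional to that of a sum of n-1 independent uniform variables, a B-spline.
Comparing the two cases determines every moment of R (`lintegral_maxNorm_pow`).

The spline satisfies a three-term recurrence, which in differential form expresses its k-th moment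
by the value at 1 and by the integral of x^k against the even polynomial with coefficients c_{j,n}
(`integral_pow_mul_truncSum`). Thus E R^k = n ∏_{j≥1} (s+2j) / B_n(s) at s = k+1
(`integral_maxNorm_pow`), which by the partial fraction decomposition is ∑ b_j / (k+1-a_j), the k-th
moment of p(r) = ∑ b_j r^(-a_j) on [0, 1].

Since B_n > 0 on (0, ∞) (`eval_B_pos`), all a_j ≤ 0 and p is continuous. By Weierstrass
approximation the law of R integrates continuous functions as p does. But near 0 the term b_0
r^(-a_0) dominates, so b_0 < 0 makes p negative there, which is impossible for a measure
(`false_of_moments_eq`). -/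

namespace RBS

/-! ### Convolution powers of the uniform density as splines -/

/-- The alternating sum of truncated powers that is proportional to the density of the sum of `N`
independent uniform variables over `[-1, 1]`. -/
noncomputable def truncSum (N : ℕ) (x : ℝ) : ℝ :=
  ∑ k ∈ Finset.range (N + 1), (-1) ^ k * (N.choose k : ℝ) * (max ((N : ℝ) - 2 * k + x) 0) ^ (N - 1)

theorem unifConv_succ (m : ℕ) (x : ℝ) :
    unifConv (m + 1) x = 1 / 2 * ∫ t in (x - 1)..(x + 1), unifConv m t := by
  have h1 : unifConv (m + 1) x = ∫ t, (Set.Icc (-1 : ℝ) 1).indicator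
      (fun t => 1 / 2 * unifConv m (x - t)) t := by
    change convolution unifDensity (unifConv m) (ContinuousLinearMap.mul ℝ ℝ) volume x = _
    unfold convolution
    refine integral_congr_ae (Filter.Eventually.of_forall fun t => ?_)
    simp only [ContinuousLinearMap.mul_apply', unifDensity, Set.indicator_apply]
    split_ifs <;> simp
  rw [h1, integral_indicator measurableSet_Icc, integral_Icc_eq_integral_Ioc,
    ← intervalIntegral.integral_of_le (by norm_num), intervalIntegral.integral_const_mul,
    intervalIntegral.integral_comp_sub_left (fun t => unifConv m t) x]
  norm_num

theorem unifConv_nonneg (m : ℕ) (x : ℝ) : 0 ≤ unifConv m x := by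
  induction m generalizing x with
  | zero =>
    change 0 ≤ unifDensity x
    unfold unifDensity
    exact Set.indicator_nonneg (fun _ _ => by norm_num) x
  | succ m ih =>
    rw [unifConv_succ]
    exact mul_nonneg (by norm_num) (intervalIntegral.integral_nonneg (by linarith) fun u _ => ih u)

theorem unifConv_neg (m : ℕ) (x : ℝ) : unifConv m (-x) = unifConv m x := by
  induction m generalizing x with
  | zero =>
    change unifDensity (-x) = unifDensity x
    simp only [unifDensity, Set.indicator_apply, Set.mem_Icc]
    congr 1
    exact propext ⟨fun h => ⟨by linarith, by linarith⟩, fun h => ⟨by linarith, by linarith⟩⟩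
  | succ m ih =>
    rw [unifConv_succ, unifConv_succ]
    have := intervalIntegral.integral_comp_neg (a := x - 1) (b := x + 1) (fun t => unifConv m t)
    simp only [ih] at this
    rw [this]
    congr 2 <;> ring

theorem hasDerivAt_max_zero_pow (p : ℕ) (x : ℝ) :
    HasDerivAt (fun y : ℝ => (max y 0) ^ (p + 2)) ((p + 2 : ℝ) * (max x 0) ^ (p + 1)) x := by
  rcases lt_trichotomy x 0 with h | h | h
  · have : (fun y : ℝ => (max y 0) ^ (p + 2)) =ᶠ[nhds x] fun _ => 0 := by
      filter_upwards [gt_mem_nhds h] with y hy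
      simp [max_eq_right hy.le]
    rw [max_eq_right h.le]
    simpa using (hasDerivAt_const x (0 : ℝ)).congr_of_eventuallyEq this
  · subst h
    rw [hasDerivAt_iff_isLittleO_nhds_zero]
    simp only [zero_add, max_self, ne_eq, Nat.add_eq_zero_iff, one_ne_zero, and_false,
      not_false_eq_true, zero_pow, mul_zero, smul_zero, sub_zero, OfNat.ofNat_ne_zero]
    refine Asymptotics.IsBigO.trans_isLittleO (g := fun h : ℝ => h ^ (p + 2)) ?_ ?_
    · refine Asymptotics.isBigO_of_le _ fun y => ?_
      rw [norm_pow, norm_pow]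
      gcongr
      rw [Real.norm_eq_abs, Real.norm_eq_abs, abs_of_nonneg (le_max_right _ _)]
      exact max_le (le_abs_self _) (abs_nonneg _)
    · simpa using Asymptotics.isLittleO_pow_pow (𝕜 := ℝ) (show 1 < p + 2 by omega)
  · have : (fun y : ℝ => (max y 0) ^ (p + 2)) =ᶠ[nhds x] fun y => y ^ (p + 2) := by
      filter_upwards [lt_mem_nhds h] with y hy
      rw [max_eq_left hy.le]
    rw [max_eq_left h.le]
    have h2 := (hasDerivAt_pow (p + 2) x).congr_of_eventuallyEq this
    simpa using h2

theorem continuous_truncSum (N : ℕ) : Continuous (truncSum N) := by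
  unfold truncSum
  fun_prop

/-- The derivative of an antiderivative of `truncSum (p + 2)`. -/
theorem hasDerivAt_sum_truncated (p N : ℕ) (w a : ℕ → ℝ) (x : ℝ) :
    HasDerivAt (fun x => ∑ k ∈ Finset.range N, w k * (max (a k + x) 0) ^ (p + 2))
      ((p + 2 : ℝ) * ∑ k ∈ Finset.range N, w k * (max (a k + x) 0) ^ (p + 1)) x := by
  rw [Finset.mul_sum]
  refine HasDerivAt.fun_sum fun k _ => ?_
  exact (((hasDerivAt_max_zero_pow p (a k + x)).comp_const_add (a k) x).const_mul
    (w k)).congr_deriv (by ring)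

/-- Pascal's rule for alternating sums. -/
theorem sum_alternating_choose_succ (N : ℕ) (F : ℕ → ℝ) :
    ∑ k ∈ Finset.range (N + 2), (-1) ^ k * ((N + 1).choose k : ℝ) * F k =
      ∑ k ∈ Finset.range (N + 1), (-1) ^ k * (N.choose k : ℝ) * (F k - F (k + 1)) := by
  have h1 : ∑ k ∈ Finset.range (N + 1), (-1) ^ k * (N.choose k : ℝ) * F k =
      ∑ k ∈ Finset.range (N + 1), (-1) ^ (k + 1) * (N.choose (k + 1) : ℝ) * F (k + 1) + F 0 := by
    have h := Finset.sum_range_succ' (fun k => (-1) ^ k * (N.choose k : ℝ) * F k) (N + 1)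
    rw [Finset.sum_range_succ, Nat.choose_succ_self] at h
    simpa using h
  simp only [mul_sub, Finset.sum_sub_distrib]
  rw [h1, Finset.sum_range_succ', add_sub_right_comm, ← Finset.sum_sub_distrib]
  congr 1
  · refine Finset.sum_congr rfl fun k _ => ?_
    rw [Nat.choose_succ_succ]
    push_cast
    ring
  · simp

/-- The closed form starts only at the twofold convolution: in `truncSum 1` the exponent is 0, the
truncation is lost because 0 ^ 0 = 1, and the sum vanishes identically. -/
theorem unifConv_one (x : ℝ) : unifConv 1 x = 1 / 4 * truncSum 2 x := by
  rw [unifConv_succ, intervalIntegral.integral_of_le (by linarith),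
    ← integral_Icc_eq_integral_Ioc]
  have : ∫ t in Set.Icc (x - 1) (x + 1), unifConv 0 t =
      1 / 2 * max (min (x + 1) 1 - max (x - 1) (-1)) 0 := by
    change ∫ t in Set.Icc (x - 1) (x + 1), (Set.Icc (-1 : ℝ) 1).indicator (fun _ => 1 / 2) t = _
    rw [setIntegral_indicator measurableSet_Icc, Set.Icc_inter_Icc, setIntegral_const,
      Measure.real, Real.volume_Icc, ENNReal.toReal_ofReal', smul_eq_mul]
    ring
  rw [this]
  have h2 : truncSum 2 x = max (2 + x) 0 - 2 * max x 0 + max (x - 2) 0 := by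
    simp [truncSum, Finset.sum_range_succ]
    ring_nf
  rw [h2]
  have h3 : max (min (x + 1) 1 - max (x - 1) (-1)) 0 =
      max (2 + x) 0 - 2 * max x 0 + max (x - 2) 0 := by
    rcases le_total x 0 with h | h
    · rw [max_eq_right h, max_eq_right (show x - 2 ≤ 0 by linarith),
        min_eq_left (by linarith), max_eq_right (show x - 1 ≤ -1 by linarith)]
      ring_nf
    · rw [max_eq_left h, max_eq_left (show 0 ≤ 2 + x by linarith),
        min_eq_right (by linarith)]
      rcases le_total x 2 with h' | h'
      · rw [max_eq_right (show x - 2 ≤ 0 by linarith),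
          max_eq_left (by rw [sub_nonneg]; exact max_le (by linarith) (by linarith))]
        rcases le_total (x - 1) (-1) with h'' | h''
        · rw [max_eq_right h'']; linarith
        · rw [max_eq_left h'']; ring
      · rw [max_eq_left (show 0 ≤ x - 2 by linarith), max_eq_left (show -1 ≤ x - 1 by linarith),
          max_eq_right (by linarith)]
        ring
  rw [h3]
  ring

/-- Convolving with the uniform density is averaging over [x-1, x+1]. The antiderivative of the
spline, taken at x+1 and at x-1, gives truncated powers whose nodes differ by one step of the index,
and Pascal's rule merges them. -/
theorem unifConv_eq_truncSum (j : ℕ) (x : ℝ) :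
    unifConv (j + 1) x = 1 / ((j + 1).factorial * 2 ^ (j + 2) : ℝ) * truncSum (j + 2) x := by
  induction j generalizing x with
  | zero => rw [unifConv_one]; norm_num
  | succ j ih =>
    rw [unifConv_succ, intervalIntegral.integral_congr (fun t _ => ih t),
      intervalIntegral.integral_const_mul]
    have hFTC : ∫ t in (x - 1)..(x + 1), (j + 2 : ℝ) * truncSum (j + 2) t = _ :=
      intervalIntegral.integral_eq_sub_of_hasDerivAt
        (fun t _ => hasDerivAt_sum_truncated j (j + 2 + 1)
          (fun k => (-1) ^ k * ((j + 2).choose k : ℝ)) (fun k => ((j + 2 : ℕ) : ℝ) - 2 * k) t)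
        ((continuous_truncSum _).const_mul _ |>.intervalIntegrable _ _)
    rw [intervalIntegral.integral_const_mul] at hFTC
    have hP : truncSum (j + 1 + 2) x = (j + 2 : ℝ) * ∫ t in (x - 1)..(x + 1), truncSum (j + 2) t := by
      rw [hFTC, truncSum, sum_alternating_choose_succ (j + 2), ← Finset.sum_sub_distrib]
      refine Finset.sum_congr rfl fun k _ => ?_
      rw [← mul_sub]
      push_cast
      congr 4 <;> ring_nf
    rw [hP, Nat.factorial_succ (j + 1)]
    push_cast
    field_simp
    ring

/-! ### Symmetry, recurrence and moments of the splines -/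

theorem truncSum_neg (N : ℕ) (x : ℝ) : truncSum (N + 2) (-x) = truncSum (N + 2) x := by
  have h := unifConv_neg (N + 1) x
  rw [unifConv_eq_truncSum, unifConv_eq_truncSum] at h
  exact mul_left_cancel₀ (by positivity) h

theorem truncSum_nonneg (N : ℕ) (x : ℝ) : 0 ≤ truncSum (N + 2) x := by
  have h := unifConv_nonneg (N + 1) x
  rw [unifConv_eq_truncSum] at h
  exact (mul_nonneg_iff_of_pos_left (by positivity)).1 h

/-- Rests on (N+1-2k) C(N+1, k) = (N+1) (C(N, k) - C(N, k-1)), followed by a shift of the index. -/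
theorem sum_alternating_choose_succ_mul (N : ℕ) (F : ℕ → ℝ) :
    ∑ k ∈ Finset.range (N + 2), (-1) ^ k * ((N + 1).choose k : ℝ) * (((N : ℝ) + 1 - 2 * k) * F k) =
      (N + 1 : ℝ) * ∑ k ∈ Finset.range (N + 1), (-1) ^ k * (N.choose k : ℝ) * (F k + F (k + 1)) := by
  have h1 : ∑ k ∈ Finset.range (N + 1), (-1) ^ k * (N.choose k : ℝ) * F k =
      ∑ k ∈ Finset.range (N + 1), (-1) ^ (k + 1) * (N.choose (k + 1) : ℝ) * F (k + 1) + F 0 := by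
    have h := Finset.sum_range_succ' (fun k => (-1) ^ k * (N.choose k : ℝ) * F k) (N + 1)
    rw [Finset.sum_range_succ, Nat.choose_succ_self] at h
    simpa using h
  simp only [mul_add, Finset.sum_add_distrib]
  rw [h1, Finset.sum_range_succ', mul_add, add_right_comm, ← mul_add, ← Finset.sum_add_distrib,
    Finset.mul_sum]
  congr 1
  · refine Finset.sum_congr rfl fun k _ => ?_
    have e1 := Nat.add_one_mul_choose_eq N k
    have e2 := Nat.choose_succ_succ N k
    have e1' : ((N : ℝ) + 1) * (N.choose k : ℝ) = ((N + 1).choose (k + 1) : ℝ) * (k + 1) := by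
      exact_mod_cast e1
    have e2' : ((N + 1).choose (k + 1) : ℝ) = N.choose k + N.choose (k + 1) := by
      exact_mod_cast e2
    have e3 : ((N : ℝ) + 1 - 2 * (k + 1)) * ((N + 1).choose (k + 1) : ℝ) =
        (N + 1) * (N.choose (k + 1) - N.choose k) := by
      linear_combination (2 : ℝ) * e1' + ((N : ℝ) + 1) * e2'
    push_cast
    linear_combination ((-1) ^ (k + 1) * F (k + 1)) * e3
  · simp

/-- The three-term recurrence of the splines. -/
theorem truncSum_sub_mul_sum (N : ℕ) (x : ℝ) :
    truncSum (N + 3) x - x * ∑ k ∈ Finset.range (N + 3 + 1), (-1) ^ k * ((N + 3).choose k : ℝ) *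
        (max (((N + 3 : ℕ) : ℝ) - 2 * k + x) 0) ^ (N + 1) =
      ((N : ℝ) + 3) * (truncSum (N + 2) (x + 1) + truncSum (N + 2) (x - 1)) := by
  have h3 := sum_alternating_choose_succ_mul (N + 2)
    (fun k => (max (((N + 3 : ℕ) : ℝ) - 2 * k + x) 0) ^ (N + 1))
  have h4 : truncSum (N + 3) x - x * ∑ k ∈ Finset.range (N + 3 + 1),
      (-1) ^ k * ((N + 3).choose k : ℝ) *
        (max (((N + 3 : ℕ) : ℝ) - 2 * k + x) 0) ^ (N + 1) = ∑ k ∈ Finset.range (N + 2 + 2),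
      (-1) ^ k * ((N + 2 + 1).choose k : ℝ) * ((((N + 2 : ℕ) : ℝ) + 1 - 2 * k) *
        (max (((N + 3 : ℕ) : ℝ) - 2 * k + x) 0) ^ (N + 1)) := by
    rw [truncSum, Finset.mul_sum, ← Finset.sum_sub_distrib]
    refine Finset.sum_congr rfl fun k _ => ?_
    -- One factor N+3-2k+x is split off the truncated power. The subtracted sum cancels its x, and
    -- N+3-2k is left to be absorbed by the binomial coefficient.
    have h5 : ∀ y : ℝ, (max y 0) ^ (N + 3 - 1) = y * (max y 0) ^ (N + 1) := fun y => by
      rcases le_total y 0 with h | h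
      · simp [max_eq_right h]
      · rw [max_eq_left h, show N + 3 - 1 = N + 2 by omega]; ring
    rw [h5]
    push_cast
    ring
  rw [h4, h3, truncSum, truncSum, ← Finset.sum_add_distrib]
  push_cast
  congr 1
  · ring
  · refine Finset.sum_congr rfl fun k _ => ?_
    rw [← mul_add]
    congr 2
    · congr 2; ring
    · congr 2; ring

/-- The three-term recurrence of the splines, in differential form. -/
theorem hasDerivAt_pow_mul_truncSum (N k : ℕ) (x : ℝ) :
    HasDerivAt (fun x => x ^ (k + 1) * truncSum (N + 3) x)
      (((N : ℝ) + 3 + k) * (x ^ k * truncSum (N + 3) x) - ((N : ℝ) + 3) * (N + 2) *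
        (x ^ k * (truncSum (N + 2) (x + 1) + truncSum (N + 2) (x - 1)))) x := by
  have h1 := hasDerivAt_sum_truncated N (N + 3 + 1)
    (fun k => (-1) ^ k * ((N + 3).choose k : ℝ)) (fun k => ((N + 3 : ℕ) : ℝ) - 2 * k) x
  refine ((hasDerivAt_pow (k + 1) x).fun_mul h1).congr_deriv ?_
  have key := truncSum_sub_mul_sum N x
  have hT : ∑ k ∈ Finset.range (N + 3 + 1), (-1) ^ k * ((N + 3).choose k : ℝ) *
    (max (((N + 3 : ℕ) : ℝ) - 2 * k + x) 0) ^ (N + 2) = truncSum (N + 3) x := rfl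
  rw [hT, Nat.add_sub_cancel, Nat.cast_add_one]
  linear_combination (-((N : ℝ) + 2) * x ^ k) * key

/-- The derivative of x^(k+1) times the spline, integrated over [0, 1]; the boundary term at 0
vanishes. With n = N+4 the last integrand is x^k times the even polynomial that defines the c_{j,n}.
-/
theorem integral_pow_mul_truncSum (N k : ℕ) :
    ((N : ℝ) + 3 + k) * ∫ x in (0 : ℝ)..1, x ^ k * truncSum (N + 3) x =
      truncSum (N + 3) 1 + ((N : ℝ) + 3) * (N + 2) *
        ∫ x in (0 : ℝ)..1, x ^ k * (truncSum (N + 2) (x + 1) + truncSum (N + 2) (x - 1)) := by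
  have c1 := continuous_truncSum (N + 3)
  have c2 := continuous_truncSum (N + 2)
  have h := intervalIntegral.integral_eq_sub_of_hasDerivAt (a := 0) (b := 1)
    (fun x _ => hasDerivAt_pow_mul_truncSum N k x)
    (Continuous.intervalIntegrable (by fun_prop) _ _)
  rw [intervalIntegral.integral_sub (Continuous.intervalIntegrable (by fun_prop) _ _)
    (Continuous.intervalIntegrable (by fun_prop) _ _), intervalIntegral.integral_const_mul,
    intervalIntegral.integral_const_mul] at h
  simp only [one_pow, one_mul, ne_eq, Nat.add_eq_zero_iff, one_ne_zero, and_false,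
    not_false_eq_true, zero_pow, zero_mul, sub_zero] at h
  linarith

/-- The spline of the next order is evaluated at 0 in two ways: by the recurrence, giving the value
at 1, and as an average over [-1, 1], giving the integral. This trades the value at 1 inside C_n for
the total mass. -/
theorem integral_truncSum (N : ℕ) :
    ((N : ℝ) + 3) * ∫ x in (0 : ℝ)..1, truncSum (N + 3) x = ((N : ℝ) + 4) * truncSum (N + 3) 1 := by
  have h1 := truncSum_sub_mul_sum (N + 1) 0
  rw [zero_mul, sub_zero, zero_add, zero_sub, truncSum_neg] at h1
  have h2 := unifConv_succ (N + 2) 0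
  rw [unifConv_eq_truncSum, intervalIntegral.integral_congr
    (fun t _ => unifConv_eq_truncSum (N + 1) t), intervalIntegral.integral_const_mul,
    zero_add, zero_sub, ← intervalIntegral.integral_add_adjacent_intervals (b := 0)
      ((continuous_truncSum _).intervalIntegrable _ _)
      ((continuous_truncSum _).intervalIntegrable _ _)] at h2
  have h3 := intervalIntegral.integral_comp_neg (a := 0) (b := 1) (truncSum (N + 3))
  simp only [truncSum_neg, neg_zero] at h3
  change _ = 1 / 2 * (1 / ((N + 1 + 1).factorial * 2 ^ (N + 1 + 2)) *
    ((∫ x in (-1 : ℝ)..0, truncSum (N + 3) x) + ∫ x in (0 : ℝ)..1, truncSum (N + 3) x)) at h2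
  rw [← h3, show N + 2 + 2 = N + 1 + 3 by omega, h1, Nat.factorial_succ] at h2
  push_cast at h2
  field_simp at h2
  have h4 : (2 : ℝ) ^ N * 16 * (((N : ℝ) + 4) * truncSum (N + 3) 1 - ((N : ℝ) + 3) *
    ∫ x in (0 : ℝ)..1, truncSum (N + 3) x) = 0 := by
    ring_nf at h2 ⊢
    linarith
  have h5 := (mul_eq_zero.1 h4).resolve_left (by positivity)
  linarith

/-! ### The polynomial B_n and the spline moments -/

theorem sum_coeffC_eq (N : ℕ) (s : ℝ) (hs : s ∈ Set.Icc (0 : ℝ) 1) :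
    ∑ j ∈ Finset.range (alpha (N + 4) + 1), coeffC (N + 4) j * s ^ (2 * j) =
      truncSum (N + 2) (s + 1) + truncSum (N + 2) (s - 1) := by
  -- As n-1-2k±s = (n-2)-2k+(1±s), the sum consists of spline values at 1+s and 1-s; evenness turns
  -- the latter into s-1.
  rw [← sum_truncated_eq _ (by omega) s hs, ← truncSum_neg _ (s - 1), truncSum, truncSum,
    ← Finset.sum_add_distrib]
  refine Finset.sum_congr (by simp) fun k _ => ?_
  rw [← mul_add, show N + 4 - 2 = N + 2 by omega, show N + 4 - 3 = N + 2 - 1 by omega]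
  push_cast
  congr 4 <;> ring

theorem integral_pow_mul_sum (N k : ℕ) :
    ∫ x in (0 : ℝ)..1, x ^ k * (truncSum (N + 2) (x + 1) + truncSum (N + 2) (x - 1)) =
      ∑ j ∈ Finset.range (alpha (N + 4) + 1), coeffC (N + 4) j / ((k : ℝ) + 1 + 2 * j) := by
  have : ∫ x in (0 : ℝ)..1, x ^ k * (truncSum (N + 2) (x + 1) + truncSum (N + 2) (x - 1)) =
      ∫ x in (0 : ℝ)..1, ∑ j ∈ Finset.range (alpha (N + 4) + 1),
        coeffC (N + 4) j * x ^ (k + 2 * j) := by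
    refine intervalIntegral.integral_congr fun x hx => ?_
    rw [Set.uIcc_of_le zero_le_one] at hx
    rw [← sum_coeffC_eq N x hx, Finset.mul_sum]
    exact Finset.sum_congr rfl fun j _ => by ring
  rw [this, intervalIntegral.integral_finsetSum
    fun j _ => Continuous.intervalIntegrable (by fun_prop) _ _]
  refine Finset.sum_congr rfl fun j _ => ?_
  rw [intervalIntegral.integral_const_mul, integral_pow]
  simp
  ring

/-- The sum is the integral of x^(t-1) against a sum of two nonnegative splines. Real exponents are
needed because the roots of B_n must be excluded from all of (0, ∞), not just from the integers. -/
theorem sum_coeffC_div_nonneg (N : ℕ) {t : ℝ} (ht : 0 < t) :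
    0 ≤ ∑ j ∈ Finset.range (alpha (N + 4) + 1), coeffC (N + 4) j / (t + 2 * j) := by
  have : ∫ x in (0 : ℝ)..1, x ^ (t - 1) *
        (truncSum (N + 2) (x + 1) + truncSum (N + 2) (x - 1)) =
      ∑ j ∈ Finset.range (alpha (N + 4) + 1), coeffC (N + 4) j / (t + 2 * j) := by
    have : ∫ x in (0 : ℝ)..1, x ^ (t - 1) *
        (truncSum (N + 2) (x + 1) + truncSum (N + 2) (x - 1)) =
      ∫ x in (0 : ℝ)..1, ∑ j ∈ Finset.range (alpha (N + 4) + 1),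
        coeffC (N + 4) j * x ^ (t - 1 + 2 * j) := by
      rw [intervalIntegral.integral_of_le zero_le_one, intervalIntegral.integral_of_le zero_le_one]
      refine setIntegral_congr_fun measurableSet_Ioc fun x hx => ?_
      rw [← sum_coeffC_eq N x ⟨hx.1.le, hx.2⟩, Finset.mul_sum]
      refine Finset.sum_congr rfl fun j _ => ?_
      rw [Real.rpow_add hx.1, ← Nat.cast_ofNat (R := ℝ) (n := 2), ← Nat.cast_mul,
        Real.rpow_natCast]
      ring
    have hj : ∀ j : ℕ, -1 < t - 1 + 2 * (j : ℝ) := fun j => by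
      have : (0 : ℝ) ≤ j := j.cast_nonneg
      linarith
    rw [this, intervalIntegral.integral_finsetSum
      fun j _ => (intervalIntegral.intervalIntegrable_rpow' (hj j)).const_mul _]
    refine Finset.sum_congr rfl fun j _ => ?_
    rw [intervalIntegral.integral_const_mul, integral_rpow (Or.inl (hj j)), Real.one_rpow,
      Real.zero_rpow (by linarith [hj j])]
    ring
  rw [← this]
  refine intervalIntegral.integral_nonneg zero_le_one fun x hx => ?_
  exact mul_nonneg (Real.rpow_nonneg hx.1 _)
    (add_nonneg (truncSum_nonneg _ _) (truncSum_nonneg _ _))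

theorem normConst_eq (N : ℕ) : normConst (N + 4) = ((N : ℝ) + 2) / truncSum (N + 3) 1 := by
  have h : phi (N + 4 + 1) 1 = unifConv (N + 1 + 1) 1 := rfl
  rw [normConst, h, unifConv_eq_truncSum, show N + 4 - 3 = N + 1 by omega,
    show N + 4 - 1 = N + 3 by omega, show N + 1 + 2 = N + 3 by omega, Nat.factorial_succ (N + 1)]
  push_cast
  -- If the value were 0, both quotients would be 0 by convention, so its positivity is not needed
  -- here.
  rcases eq_or_ne (truncSum (N + 3) 1) 0 with h0 | h0
  · simp [h0]
  · field_simp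
    ring

theorem eval_B (n : ℕ) {t : ℝ} (ht : 0 < t) :
    (B n).eval t = (∏ j ∈ Finset.range (alpha n + 1), (t + 2 * (j : ℝ))) *
      (1 + ((n : ℝ) - 1) * normConst n *
        ∑ j ∈ Finset.range (alpha n + 1), coeffC n j / (t + 2 * j)) := by
  rw [B, mul_add, mul_one, mul_left_comm]
  simp only [eval_add, eval_prod, eval_X, eval_C, eval_mul, eval_finsetSum]
  congr 2
  rw [Finset.mul_sum]
  refine Finset.sum_congr rfl fun j hj => ?_
  rw [← Finset.mul_prod_erase _ _ hj]
  have : t + 2 * (j : ℝ) ≠ 0 := by positivity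
  field_simp

theorem eval_B_pos (N : ℕ) {t : ℝ} (ht : 0 < t) : 0 < (B (N + 4)).eval t := by
  rw [eval_B _ ht]
  refine mul_pos (Finset.prod_pos fun j _ => by positivity) ?_
  have h1 := sum_coeffC_div_nonneg N ht
  have h2 : 0 ≤ normConst (N + 4) := by
    rw [normConst_eq]
    exact div_nonneg (by positivity) (truncSum_nonneg _ _)
  have h3 : (0 : ℝ) ≤ ((N + 4 : ℕ) : ℝ) - 1 := by push_cast; linarith [(N.cast_nonneg : (0 : ℝ) ≤ N)]
  have := mul_nonneg (mul_nonneg h3 h2) h1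
  linarith

/-- The ratio of the moments of the splines, in terms of the polynomial `B n`. -/
theorem integral_pow_mul_truncSum_mul (N k : ℕ)
    (h0 : ∫ x in (0 : ℝ)..1, truncSum (N + 3) x ≠ 0) :
    (((N : ℝ) + 3 + k) * ∫ x in (0 : ℝ)..1, x ^ k * truncSum (N + 3) x) *
        (((N : ℝ) + 4) * ∏ j ∈ Finset.range (alpha (N + 4) + 1), ((k : ℝ) + 1 + 2 * (j : ℝ))) =
      (((N : ℝ) + 3) * ∫ x in (0 : ℝ)..1, truncSum (N + 3) x) * (B (N + 4)).eval ((k : ℝ) + 1) := by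
  have hI := integral_truncSum N
  have h1 : truncSum (N + 3) 1 ≠ 0 := fun h => by
    rw [h, mul_zero] at hI
    exact (mul_ne_zero (by positivity) h0) hI
  rw [integral_pow_mul_truncSum, hI, integral_pow_mul_sum, eval_B _ (by positivity), normConst_eq]
  push_cast
  field_simp
  ring

/-! ### Sums of independent uniform variables -/

theorem measurable_unifConv (m : ℕ) : Measurable (unifConv m) := by
  cases m with
  | zero => exact measurable_const.indicator measurableSet_Icc
  | succ m =>
    rw [funext (unifConv_eq_truncSum m)]
    exact ((continuous_truncSum _).const_mul _).measurable

theorem intervalIntegrable_unifConv (m : ℕ) (x y : ℝ) :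
    IntervalIntegrable (unifConv m) volume x y := by
  cases m with
  | zero =>
    have : Integrable unifDensity := (integrable_indicator_iff measurableSet_Icc).2
      (integrableOn_const (by simp))
    exact this.intervalIntegrable
  | succ m =>
    rw [funext (unifConv_eq_truncSum m)]
    exact ((continuous_truncSum _).const_mul _).intervalIntegrable _ _

theorem lintegral_Icc_unifConv_sub (m : ℕ) (u : ℝ) :
    ∫⁻ x in Set.Icc (-1 : ℝ) 1, ENNReal.ofReal (unifConv m (u - x)) =
      2 * ENNReal.ofReal (unifConv (m + 1) u) := by
  have hii : IntervalIntegrable (fun x => unifConv m (u - x)) volume (-1) 1 := by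
    have := (intervalIntegrable_unifConv m (u - -1) (u - 1)).comp_sub_left u
    simpa using this
  rw [← ofReal_integral_eq_lintegral_ofReal, integral_Icc_eq_integral_Ioc,
    ← intervalIntegral.integral_of_le (by norm_num),
    intervalIntegral.integral_comp_sub_left (fun t => unifConv m t) u, unifConv_succ,
    ← ENNReal.ofReal_ofNat, ← ENNReal.ofReal_mul (by norm_num)]
  · congr 1
    rw [sub_neg_eq_add]
    ring
  · rw [← IntegrableOn, integrableOn_Icc_iff_integrableOn_Ioc]
    exact (intervalIntegrable_iff_integrableOn_Ioc_of_le (by norm_num)).1 hii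
  · exact Filter.Eventually.of_forall fun x => unifConv_nonneg _ _

/-- The density of the sum of independent uniform variables. -/
theorem lintegral_pi_Icc_sum (m : ℕ) {F : ℝ → ℝ≥0∞} (hF : Measurable F) :
    ∫⁻ y, F (∑ i, y i) ∂(Measure.pi fun _ : Fin (m + 1) => volume.restrict (Set.Icc (-1 : ℝ) 1)) =
      2 ^ (m + 1) * ∫⁻ u, F u * ENNReal.ofReal (unifConv m u) := by
  -- Fubini with the first coordinate split off; each further coordinate then acts as one more
  -- convolution.
  have hsplit : ∀ m : ℕ, ∀ F : ℝ → ℝ≥0∞, Measurable F →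
      ∫⁻ y, F (∑ i, y i)
        ∂(Measure.pi fun _ : Fin (m + 1) => volume.restrict (Set.Icc (-1 : ℝ) 1)) =
      ∫⁻ x in Set.Icc (-1 : ℝ) 1, ∫⁻ z, F (x + ∑ i, z i)
        ∂(Measure.pi fun _ : Fin m => volume.restrict (Set.Icc (-1 : ℝ) 1)) := by
    intro m F hF
    have hmp := measurePreserving_piFinSuccAbove
      (fun _ : Fin (m + 1) => volume.restrict (Set.Icc (-1 : ℝ) 1)) 0
    rw [← lintegral_prod (fun p : ℝ × (Fin m → ℝ) => F (p.1 + ∑ i, p.2 i))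
      (Measurable.aemeasurable (by fun_prop)), ← hmp.lintegral_comp (by fun_prop)]
    refine lintegral_congr fun y => ?_
    rw [Fin.sum_univ_succ]
    rfl
  induction m generalizing F with
  | zero =>
    rw [hsplit 0 F hF]
    have hφ := measurable_unifConv 0
    simp only [Finset.univ_eq_empty, Finset.sum_empty, add_zero, lintegral_const,
      Measure.pi_empty_univ, mul_one, zero_add, pow_one]
    rw [← lintegral_indicator measurableSet_Icc, ← lintegral_const_mul _ (by fun_prop)]
    refine lintegral_congr fun u => ?_
    change _ = 2 * (F u * ENNReal.ofReal (unifDensity u))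
    simp only [unifDensity, Set.indicator_apply]
    split_ifs
    · rw [mul_left_comm, ← ENNReal.ofReal_ofNat, ← ENNReal.ofReal_mul (by norm_num)]
      norm_num
    · simp
  | succ m ih =>
    have hφ := measurable_unifConv m
    have hφ' := measurable_unifConv (m + 1)
    rw [hsplit (m + 1) F hF]
    have h1 : ∀ x : ℝ, ∫⁻ z, F (x + ∑ i, z i)
        ∂(Measure.pi fun _ : Fin (m + 1) => volume.restrict (Set.Icc (-1 : ℝ) 1)) =
        2 ^ (m + 1) * ∫⁻ u, F u * ENNReal.ofReal (unifConv m (u - x)) := fun x => by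
      rw [ih (F := fun u => F (x + u)) (by fun_prop), ← lintegral_add_left_eq_self
        (fun u => F u * ENNReal.ofReal (unifConv m (u - x))) x]
      simp
    simp only [h1]
    rw [lintegral_const_mul _ (Measurable.lintegral_prod_right (by fun_prop)),
      lintegral_lintegral_swap (Measurable.aemeasurable (by fun_prop)), pow_succ _ (m + 1),
      mul_assoc]
    congr 1
    rw [← lintegral_const_mul _ (by fun_prop)]
    refine lintegral_congr fun u => ?_
    rw [lintegral_const_mul _ (by fun_prop), lintegral_Icc_unifConv_sub, mul_left_comm]

/-! ### Polar integration for the maximum norm -/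

/-- A measure whose distribution function is a multiple of `r ^ (p + 1)` on `[0, 1]`. -/
theorem eq_smul_withDensity_of_Iic {ν : Measure ℝ} [IsFiniteMeasure ν] {A : ℝ≥0∞} (p : ℕ)
    (hneg : ∀ r < 0, ν (Set.Iic r) = 0)
    (hmid : ∀ r ∈ Set.Icc (0 : ℝ) 1, ν (Set.Iic r) = A * ENNReal.ofReal (r ^ (p + 1)))
    (hbig : ∀ r > 1, ν (Set.Iic r) = A) :
    ν = A • (volume.restrict (Set.Ioc (0 : ℝ) 1)).withDensity
      fun r => ENNReal.ofReal ((p + 1) * r ^ p) := by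
  have key : ∀ r ∈ Set.Icc (0 : ℝ) 1, ∫⁻ x in Set.Ioc 0 r, ENNReal.ofReal ((p + 1) * x ^ p) =
      ENNReal.ofReal (r ^ (p + 1)) := fun r hr => by
    rw [← ofReal_integral_eq_lintegral_ofReal, ← intervalIntegral.integral_of_le hr.1,
      intervalIntegral.integral_const_mul, integral_pow]
    · congr 1
      have : (p : ℝ) + 1 ≠ 0 := by positivity
      field_simp
      simp
    · exact (intervalIntegrable_iff_integrableOn_Ioc_of_le hr.1).1
        (Continuous.intervalIntegrable (by fun_prop) _ _)
    · refine (ae_restrict_iff' measurableSet_Ioc).2 (Filter.Eventually.of_forall fun x hx => ?_)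
      have := hx.1
      positivity
  refine Measure.ext_of_Iic _ _ fun r => ?_
  rw [Measure.smul_apply, withDensity_apply _ measurableSet_Iic,
    Measure.restrict_restrict measurableSet_Iic, smul_eq_mul]
  rcases lt_or_ge r 0 with h0 | h0
  · have : Set.Iic r ∩ Set.Ioc (0 : ℝ) 1 = ∅ := by
      ext x
      simp only [Set.mem_inter_iff, Set.mem_Iic, Set.mem_Ioc, Set.mem_empty_iff_false, iff_false]
      intro h
      linarith [h.1, h.2.1]
    rw [hneg r h0, this]
    simp
  · rcases le_or_gt r 1 with h1 | h1
    · have : Set.Iic r ∩ Set.Ioc (0 : ℝ) 1 = Set.Ioc 0 r := by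
        ext x
        simp only [Set.mem_inter_iff, Set.mem_Iic, Set.mem_Ioc]
        exact ⟨fun h => ⟨h.2.1, h.1⟩, fun h => ⟨h.2, h.1, h.2.trans h1⟩⟩
      rw [hmid r ⟨h0, h1⟩, this, key r ⟨h0, h1⟩]
    · have : Set.Iic r ∩ Set.Ioc (0 : ℝ) 1 = Set.Ioc 0 1 := by
        ext x
        simp only [Set.mem_inter_iff, Set.mem_Iic, Set.mem_Ioc]
        exact ⟨fun h => h.2, fun h => ⟨h.2.trans h1.le, h⟩⟩
      rw [hbig r h1, this, key 1 (by simp)]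
      simp

/-- The maximum norm of the point of the hyperplane whose coordinates, but for the first, are
given. -/
noncomputable def liftNorm {N : ℕ} (y : Fin N → ℝ) : ℝ := max ‖y‖ |∑ i, y i|

theorem continuous_liftNorm {N : ℕ} : Continuous (liftNorm (N := N)) := by
  unfold liftNorm
  fun_prop

theorem liftNorm_nonneg {N : ℕ} (y : Fin N → ℝ) : 0 ≤ liftNorm y :=
  (norm_nonneg y).trans (le_max_left _ _)

theorem liftNorm_smul {N : ℕ} {r : ℝ} (hr : 0 ≤ r) (y : Fin N → ℝ) :
    liftNorm (r • y) = r * liftNorm y := by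
  simp only [liftNorm, norm_smul, Pi.smul_apply, smul_eq_mul, ← Finset.mul_sum, abs_mul,
    Real.norm_eq_abs, abs_of_nonneg hr]
  exact (mul_max_of_nonneg _ _ hr).symm

theorem measurableSet_liftNorm_le {N : ℕ} (r : ℝ) :
    MeasurableSet {y : Fin N → ℝ | liftNorm y ≤ r} :=
  measurableSet_le continuous_liftNorm.measurable measurable_const

/-- Dilation by r: volume contributes r^N and the weight r^k. -/
theorem setLIntegral_liftNorm_le {N k : ℕ} {r : ℝ} (hr : 0 < r) :
    ∫⁻ y in {y : Fin N → ℝ | liftNorm y ≤ r}, ENNReal.ofReal (|∑ i, y i| ^ k) =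
      (∫⁻ y in {y : Fin N → ℝ | liftNorm y ≤ 1}, ENNReal.ofReal (|∑ i, y i| ^ k)) *
        ENNReal.ofReal (r ^ (N + k)) := by
  rw [← lintegral_indicator (measurableSet_liftNorm_le r),
    ← lintegral_indicator (measurableSet_liftNorm_le 1)]
  set W : (Fin N → ℝ) → ℝ≥0∞ := fun y => ENNReal.ofReal (|∑ i, y i| ^ k) with hW
  have hWm : Measurable W := by fun_prop
  have h1 : ∫⁻ y, Set.indicator {y : Fin N → ℝ | liftNorm y ≤ r} W (r • y) =
      ENNReal.ofReal (r ^ k) * ∫⁻ y, Set.indicator {y : Fin N → ℝ | liftNorm y ≤ 1} W y := by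
    rw [← lintegral_const_mul _ (hWm.indicator (measurableSet_liftNorm_le 1))]
    refine lintegral_congr fun y => ?_
    have hiff : liftNorm (r • y) ≤ r ↔ liftNorm y ≤ 1 := by
      rw [liftNorm_smul hr.le]
      exact mul_le_iff_le_one_right hr
    simp only [Set.indicator_apply, Set.mem_ofPred_eq, hiff]
    split_ifs
    · simp only [hW, Pi.smul_apply, smul_eq_mul, ← Finset.mul_sum, abs_mul, abs_of_pos hr, mul_pow]
      exact ENNReal.ofReal_mul (by positivity)
    · simp
  have h2 : ∫⁻ y, Set.indicator {y : Fin N → ℝ | liftNorm y ≤ r} W (r • y) =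
      ENNReal.ofReal (r ^ N)⁻¹ * ∫⁻ y, Set.indicator {y : Fin N → ℝ | liftNorm y ≤ r} W y := by
    rw [← lintegral_map (hWm.indicator (measurableSet_liftNorm_le r)) (measurable_const_smul r),
      Measure.map_addHaar_smul volume hr.ne', lintegral_smul_measure]
    simp [abs_of_pos hr]
  rw [h2] at h1
  have h3 := congrArg (fun z => ENNReal.ofReal (r ^ N) * z) h1
  simp only [← mul_assoc, ← ENNReal.ofReal_mul (pow_nonneg hr.le N)] at h3
  rw [mul_inv_cancel₀ (by positivity), ENNReal.ofReal_one, one_mul, ← pow_add] at h3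
  rw [h3, mul_comm]

/-- Integration of functions of `liftNorm`. -/
theorem setLIntegral_mul_comp_liftNorm (M k : ℕ) {g : ℝ → ℝ≥0∞} (hg : Measurable g) :
    ∫⁻ y in {y : Fin (M + 1) → ℝ | liftNorm y ≤ 1},
        ENNReal.ofReal (|∑ i, y i| ^ k) * g (liftNorm y) =
      (∫⁻ y in {y : Fin (M + 1) → ℝ | liftNorm y ≤ 1}, ENNReal.ofReal (|∑ i, y i| ^ k)) *
        ∫⁻ r in Set.Ioc (0 : ℝ) 1, ENNReal.ofReal (((M + k : ℕ) + 1) * r ^ (M + k)) * g r := by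
  set W : (Fin (M + 1) → ℝ) → ℝ≥0∞ := fun y => ENNReal.ofReal (|∑ i, y i| ^ k) with hW
  have hWm : Measurable W := by fun_prop
  have hGm := continuous_liftNorm (N := M + 1) |>.measurable
  set S := {y : Fin (M + 1) → ℝ | liftNorm y ≤ 1} with hS
  -- The law of the norm under weighted volume on the unit ball. Homogeneity makes its distribution
  -- function a multiple of r^(M+1+k) on [0, 1], which identifies it.
  set ν := ((volume.restrict S).withDensity W).map liftNorm with hν
  have hν_Iic : ∀ r, ν (Set.Iic r) = ∫⁻ y in {y | liftNorm y ≤ r} ∩ S, W y := fun r => by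
    rw [hν, Measure.map_apply hGm measurableSet_Iic,
      withDensity_apply _ (hGm measurableSet_Iic),
      Measure.restrict_restrict (hGm measurableSet_Iic)]
    rfl
  have hfin : ∫⁻ y in S, W y < ∞ := by
    have hbd : S ⊆ Metric.closedBall 0 1 := fun y hy => by
      rw [mem_closedBall_zero_iff]
      exact (le_max_left _ _).trans hy
    have : ∫⁻ y in S, W y ≤ ∫⁻ y in S, 1 := by
      refine setLIntegral_mono measurable_const fun y hy => ?_
      rw [hW, ← ENNReal.ofReal_one]
      refine ENNReal.ofReal_le_ofReal (pow_le_one₀ (abs_nonneg _) ?_)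
      exact (le_max_right _ _).trans hy
    refine this.trans_lt ?_
    rw [setLIntegral_one]
    exact (measure_mono hbd).trans_lt measure_closedBall_lt_top
  have : IsFiniteMeasure ν := by
    have := isFiniteMeasure_withDensity hfin.ne
    exact Measure.isFiniteMeasure_map _ _
  have hνeq := eq_smul_withDensity_of_Iic (ν := ν) (A := ∫⁻ y in S, W y) (M + k) ?_ ?_ ?_
  · have h1 : ∫⁻ y in S, W y * g (liftNorm y) = ∫⁻ r, g r ∂ν := by
      rw [hν, lintegral_map hg hGm, lintegral_withDensity_eq_lintegral_mul _ hWm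
        (show Measurable fun y => g (liftNorm y) from hg.comp hGm)]
      rfl
    rw [h1, hνeq, lintegral_smul_measure, lintegral_withDensity_eq_lintegral_mul _
      (by fun_prop) hg]
    rfl
  · intro r hr
    rw [hν_Iic]
    have : {y : Fin (M + 1) → ℝ | liftNorm y ≤ r} ∩ S = ∅ := by
      ext y
      simp only [Set.mem_inter_iff, Set.mem_ofPred_eq, Set.mem_empty_iff_false, iff_false]
      intro h
      linarith [h.1, liftNorm_nonneg y]
    simp [this]
  · intro r hr
    have hsub : {y : Fin (M + 1) → ℝ | liftNorm y ≤ r} ∩ S = {y | liftNorm y ≤ r} :=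
      Set.inter_eq_left.2 fun y (hy : liftNorm y ≤ r) => hy.trans hr.2
    rw [hν_Iic, hsub]
    rcases hr.1.eq_or_lt with h0 | h0
    · subst h0
      -- The dilation argument excludes r = 0. There the ball is a point, which is null since the
      -- dimension M+1 is positive.
      have : volume {y : Fin (M + 1) → ℝ | liftNorm y ≤ 0} = 0 := by
        refine measure_mono_null (t := {0}) (fun y hy => ?_) (measure_singleton _)
        exact norm_le_zero_iff.1 ((le_max_left _ _).trans hy)
      rw [Measure.restrict_eq_zero.2 this]
      simp
    · rw [setLIntegral_liftNorm_le h0, show M + 1 + k = M + k + 1 by ring]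
  · intro r hr
    rw [hν_Iic]
    congr 2
    exact Set.inter_eq_right.2 fun y (hy : liftNorm y ≤ 1) => hy.trans (le_of_lt hr)

/-- The unit ball of `liftNorm` is the cube cut by the slab |∑ y_i| ≤ 1, so only the density of the
sum matters. The volume 2^(m+2) of the cube cancels the power of 2 in the spline normalization; the
remaining 2 comes from folding [-1, 1] onto [0, 1]. -/
theorem setLIntegral_abs_sum_pow (m k : ℕ) :
    ∫⁻ y in {y : Fin (m + 2) → ℝ | liftNorm y ≤ 1}, ENNReal.ofReal (|∑ i, y i| ^ k) =
      ENNReal.ofReal (2 / (m + 1).factorial) *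
        ENNReal.ofReal (∫ x in (0 : ℝ)..1, x ^ k * truncSum (m + 2) x) := by
  set F : ℝ → ℝ≥0∞ := (Set.Icc (-1 : ℝ) 1).indicator fun u => ENNReal.ofReal (|u| ^ k) with hF
  have hFm : Measurable F := Measurable.indicator (by fun_prop) measurableSet_Icc
  have hc := continuous_truncSum (m + 2)
  have hset : {y : Fin (m + 2) → ℝ | liftNorm y ≤ 1} =
      {y | ∑ i, y i ∈ Set.Icc (-1 : ℝ) 1} ∩ Set.univ.pi fun _ => Set.Icc (-1 : ℝ) 1 := by
    ext y
    simp only [liftNorm, Set.mem_ofPred_eq, max_le_iff, Set.mem_inter_iff, Set.mem_univ_pi,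
      pi_norm_le_iff_of_nonneg zero_le_one, Real.norm_eq_abs, abs_le, Set.mem_Icc]
    exact and_comm
  have hms : MeasurableSet {y : Fin (m + 2) → ℝ | ∑ i, y i ∈ Set.Icc (-1 : ℝ) 1} :=
    (show Measurable fun y : Fin (m + 2) → ℝ => ∑ i, y i by fun_prop) measurableSet_Icc
  rw [hset, ← Measure.restrict_restrict hms, volume_pi, Measure.restrict_pi_pi,
    ← lintegral_indicator hms]
  have h1 : ∀ y : Fin (m + 2) → ℝ, Set.indicator {y : Fin (m + 2) → ℝ |
      ∑ i, y i ∈ Set.Icc (-1 : ℝ) 1} (fun y => ENNReal.ofReal (|∑ i, y i| ^ k)) y =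
      F (∑ i, y i) := fun y => by
    simp only [hF, Set.indicator_apply, Set.mem_ofPred_eq]
  simp only [h1]
  rw [lintegral_pi_Icc_sum (m + 1) hFm]
  have h2 : ∫⁻ u, F u * ENNReal.ofReal (unifConv (m + 1) u) =
      ∫⁻ u in Set.Icc (-1 : ℝ) 1, ENNReal.ofReal (|u| ^ k * unifConv (m + 1) u) := by
    rw [← lintegral_indicator measurableSet_Icc]
    refine lintegral_congr fun u => ?_
    simp only [hF, Set.indicator_apply]
    split_ifs
    · exact (ENNReal.ofReal_mul (by positivity)).symm
    · simp
  have hcu : Continuous (unifConv (m + 1)) := by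
    rw [funext (unifConv_eq_truncSum m)]
    fun_prop
  have hii : ∀ x y : ℝ, IntervalIntegrable (fun u => |u| ^ k * unifConv (m + 1) u) volume x y :=
    fun x y => Continuous.intervalIntegrable (by fun_prop) _ _
  have h3 : ∫ u in (-1 : ℝ)..1, |u| ^ k * unifConv (m + 1) u =
      2 * ∫ u in (0 : ℝ)..1, u ^ k * unifConv (m + 1) u := by
    have e1 := intervalIntegral.integral_comp_neg (a := 0) (b := 1)
      (fun u => |u| ^ k * unifConv (m + 1) u)
    simp only [abs_neg, unifConv_neg, neg_zero] at e1
    rw [← intervalIntegral.integral_add_adjacent_intervals (hii (-1) 0) (hii 0 1), ← e1, ← two_mul]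
    congr 1
    refine intervalIntegral.integral_congr fun u hu => ?_
    rw [Set.uIcc_of_le zero_le_one] at hu
    simp only [abs_of_nonneg hu.1]
  rw [h2, ← ofReal_integral_eq_lintegral_ofReal, integral_Icc_eq_integral_Ioc,
    ← intervalIntegral.integral_of_le (by norm_num), h3,
    intervalIntegral.integral_congr (g := fun u => 1 / ((m + 1).factorial * 2 ^ (m + 2) : ℝ) *
      (u ^ k * truncSum (m + 2) u)) fun u _ => by
        simp only [unifConv_eq_truncSum]; ring,
    intervalIntegral.integral_const_mul, ← ENNReal.ofReal_ofNat, ← ENNReal.ofReal_pow (by norm_num),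
    ← ENNReal.ofReal_mul (by positivity), ← ENNReal.ofReal_mul (by positivity)]
  · congr 1
    field_simp
  · rw [← IntegrableOn, integrableOn_Icc_iff_integrableOn_Ioc]
    exact (intervalIntegrable_iff_integrableOn_Ioc_of_le (by norm_num)).1 (hii _ _)
  · exact Filter.Eventually.of_forall fun u => mul_nonneg (by positivity) (unifConv_nonneg _ _)

/-! ### The moment problem on [0, 1] -/

/-- A measure on `[0, 1]` and a signed measure with continuous density that have the same moments
agree on continuous functions. -/
theorem integral_eq_of_moments_eq {ρ : Measure ℝ} [IsFiniteMeasure ρ]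
    (hρ : ∀ᵐ r ∂ρ, r ∈ Set.Icc (0 : ℝ) 1) {p : ℝ → ℝ} (hp : Continuous p)
    (hm : ∀ k : ℕ, ∫ r, r ^ k ∂ρ = ∫ r in (0 : ℝ)..1, r ^ k * p r) {u : ℝ → ℝ}
    (hu : Continuous u) : ∫ r, u r ∂ρ = ∫ r in (0 : ℝ)..1, u r * p r := by
  have hint : ∀ v : ℝ → ℝ, Continuous v → Integrable v ρ := fun v hv => by
    obtain ⟨C, hC⟩ := (isCompact_Icc (a := (0 : ℝ)) (b := 1)).exists_bound_of_continuousOn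
      hv.continuousOn
    exact Integrable.of_bound hv.aestronglyMeasurable C (hρ.mono fun r hr => hC r hr)
  have hq : ∀ q : ℝ[X], ∫ r, q.eval r ∂ρ = ∫ r in (0 : ℝ)..1, q.eval r * p r := fun q => by
    simp only [eval_eq_sum_range, Finset.sum_mul]
    rw [integral_finsetSum _ fun i _ => (hint _ (continuous_pow i)).const_mul _,
      intervalIntegral.integral_finsetSum
        fun i _ => Continuous.intervalIntegrable (by fun_prop) _ _]
    refine Finset.sum_congr rfl fun i _ => ?_
    simp only [mul_assoc]
    rw [integral_const_mul, intervalIntegral.integral_const_mul, hm]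
  by_contra hne
  -- Replacing u by a polynomial uniformly ε-close to it changes the difference of the two integrals
  -- by at most ε K.
  set K : ℝ := ρ.real Set.univ + ∫ r in (0 : ℝ)..1, |p r| with hK
  have hK0 : 0 ≤ K := add_nonneg measureReal_nonneg
    (intervalIntegral.integral_nonneg zero_le_one fun _ _ => abs_nonneg _)
  have hd : 0 < |(∫ r, u r ∂ρ) - ∫ r in (0 : ℝ)..1, u r * p r| := abs_pos.2 (sub_ne_zero.2 hne)
  obtain ⟨ε, hε, hεK⟩ : ∃ ε > 0, ε * K < |(∫ r, u r ∂ρ) - ∫ r in (0 : ℝ)..1, u r * p r| := by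
    refine ⟨|(∫ r, u r ∂ρ) - ∫ r in (0 : ℝ)..1, u r * p r| / (K + 1), by positivity, ?_⟩
    rw [div_mul_eq_mul_div, div_lt_iff₀ (by positivity)]
    nlinarith
  obtain ⟨q, hqu⟩ := exists_polynomial_near_of_continuousOn 0 1 u hu.continuousOn ε hε
  have e1 : |(∫ r, q.eval r ∂ρ) - ∫ r, u r ∂ρ| ≤ ε * ρ.real Set.univ := by
    rw [← integral_sub (hint _ q.continuous) (hint _ hu), ← Real.norm_eq_abs]
    exact norm_integral_le_of_norm_le_const (hρ.mono fun r hr => (hqu r hr).le)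
  have e2 : |(∫ r in (0 : ℝ)..1, q.eval r * p r) - ∫ r in (0 : ℝ)..1, u r * p r| ≤
      ε * ∫ r in (0 : ℝ)..1, |p r| := by
    have hqc := q.continuous
    rw [← intervalIntegral.integral_sub (Continuous.intervalIntegrable (by fun_prop) _ _)
      (Continuous.intervalIntegrable (by fun_prop) _ _), ← Real.norm_eq_abs,
      ← intervalIntegral.integral_const_mul]
    refine intervalIntegral.norm_integral_le_of_norm_le zero_le_one ?_
      (Continuous.intervalIntegrable (by fun_prop) _ _)
    refine Filter.Eventually.of_forall fun r hr => ?_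
    rw [← sub_mul, norm_mul, Real.norm_eq_abs, Real.norm_eq_abs]
    exact mul_le_mul_of_nonneg_right (hqu r ⟨hr.1.le, hr.2⟩).le (abs_nonneg _)
  rw [hq] at e1
  have e3 := abs_sub_le (∫ r, u r ∂ρ) (∫ r in (0 : ℝ)..1, q.eval r * p r)
    (∫ r in (0 : ℝ)..1, u r * p r)
  rw [abs_sub_comm] at e1
  rw [hK, mul_add] at hεK
  linarith

/-- Near `0` a linear combination of powers has the sign of the term of lowest exponent. -/
theorem exists_sum_rpow_neg {m : ℕ} {a b : Fin (m + 1) → ℝ} (ha : StrictAnti a) (hb0 : b 0 < 0) :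
    ∃ δ > 0, δ ≤ 1 ∧ ∀ r : ℝ, 0 < r → r < δ → ∑ j, b j * r ^ (-a j) < 0 := by
  -- With r^(-a 0) factored out, the other exponents a 0 - a j are positive, so the remaining factor
  -- tends to b 0.
  have ht : Filter.Tendsto (fun r : ℝ => b 0 + ∑ j : Fin m, b j.succ * r ^ (a 0 - a j.succ))
      (nhds 0) (nhds (b 0 + ∑ j : Fin m, b j.succ * (0 : ℝ) ^ (a 0 - a j.succ))) := by
    refine tendsto_const_nhds.add (tendsto_finsetSum _ fun j _ => ?_)
    have h : a j.succ < a 0 := ha (Fin.succ_pos j)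
    exact ((Real.continuous_rpow_const (by linarith)).tendsto 0).const_mul _
  have h0 : b 0 + ∑ j : Fin m, b j.succ * (0 : ℝ) ^ (a 0 - a j.succ) < 0 := by
    rw [Finset.sum_eq_zero, add_zero]
    · exact hb0
    · intro j _
      have h : a j.succ < a 0 := ha (Fin.succ_pos j)
      rw [Real.zero_rpow (by linarith), mul_zero]
  obtain ⟨δ, hδ, hball⟩ := Metric.eventually_nhds_iff.1 (ht.eventually (gt_mem_nhds h0))
  refine ⟨min δ 1, by positivity, min_le_right _ _, fun r hr hr' => ?_⟩
  have hlt := hball (y := r) (by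
    rw [Real.dist_eq, sub_zero, abs_of_pos hr]
    exact hr'.trans_le (min_le_left _ _))
  have hfac : ∑ j, b j * r ^ (-a j) =
      r ^ (-a 0) * (b 0 + ∑ j : Fin m, b j.succ * r ^ (a 0 - a j.succ)) := by
    rw [Fin.sum_univ_succ, mul_add, Finset.mul_sum, mul_comm (b 0)]
    congr 1
    refine Finset.sum_congr rfl fun j _ => ?_
    rw [mul_left_comm, ← Real.rpow_add hr]
    congr 2
    ring
  rw [hfac]
  exact mul_neg_of_pos_of_neg (Real.rpow_pos_of_pos hr _) hlt

/-- A measure on `[0, 1]` cannot have the moments of a combination of powers whose leading term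
at `0` is negative. -/
theorem false_of_moments_eq {ρ : Measure ℝ} [IsFiniteMeasure ρ]
    (hρ : ∀ᵐ r ∂ρ, r ∈ Set.Icc (0 : ℝ) 1) {m : ℕ} {a b : Fin (m + 1) → ℝ} (ha : StrictAnti a)
    (ha0 : ∀ j, a j ≤ 0) (hb0 : b 0 < 0)
    (hm : ∀ k : ℕ, ∫ r, r ^ k ∂ρ = ∑ j, b j / ((k : ℝ) + 1 - a j)) : False := by
  have hc : ∀ j, Continuous fun r : ℝ => r ^ (-a j) := fun j =>
    Real.continuous_rpow_const (by linarith [ha0 j])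
  have hp : Continuous fun r : ℝ => ∑ j, b j * r ^ (-a j) := by fun_prop
  have hm' : ∀ k : ℕ, ∫ r, r ^ k ∂ρ = ∫ r in (0 : ℝ)..1, r ^ k * ∑ j, b j * r ^ (-a j) := by
    intro k
    simp only [Finset.mul_sum]
    rw [hm, intervalIntegral.integral_finsetSum
      fun j _ => Continuous.intervalIntegrable (by fun_prop) _ _]
    refine Finset.sum_congr rfl fun j _ => ?_
    have e : ∫ r in (0 : ℝ)..1, r ^ k * (b j * r ^ (-a j)) =
        ∫ r in (0 : ℝ)..1, b j * r ^ ((k : ℝ) - a j) := by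
      rw [intervalIntegral.integral_of_le zero_le_one, intervalIntegral.integral_of_le zero_le_one]
      refine setIntegral_congr_fun measurableSet_Ioc fun r hr => ?_
      rw [mul_left_comm, ← Real.rpow_natCast, ← Real.rpow_add hr.1, sub_eq_add_neg]
    have hk : -1 < (k : ℝ) - a j := by linarith [ha0 j, (k.cast_nonneg : (0 : ℝ) ≤ k)]
    rw [e, intervalIntegral.integral_const_mul, integral_rpow (Or.inl hk), Real.one_rpow,
      Real.zero_rpow (by linarith)]
    ring
  obtain ⟨δ, hδ, hδ1, hneg⟩ := exists_sum_rpow_neg ha hb0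
  -- A continuous nonnegative test function that vanishes beyond δ and so sees only the range where
  -- the would-be density is negative.
  have hu : Continuous fun r : ℝ => max (δ - r) 0 := by fun_prop
  have h1 := integral_eq_of_moments_eq hρ hp hm' hu
  have h2 : 0 ≤ ∫ r, max (δ - r) 0 ∂ρ := integral_nonneg fun r => le_max_right _ _
  have hii : ∀ x y : ℝ, IntervalIntegrable
      (fun r : ℝ => max (δ - r) 0 * ∑ j, b j * r ^ (-a j)) volume x y :=
    fun x y => (hu.mul hp).intervalIntegrable _ _
  rw [← intervalIntegral.integral_add_adjacent_intervals (hii 0 δ) (hii δ 1)] at h1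
  have h3 : ∫ r in δ..1, max (δ - r) 0 * ∑ j, b j * r ^ (-a j) = 0 := by
    rw [← intervalIntegral.integral_zero (a := δ) (b := 1)]
    refine intervalIntegral.integral_congr fun r hr => ?_
    rw [Set.uIcc_of_le hδ1] at hr
    simp [max_eq_right (sub_nonpos.2 hr.1)]
  have h4 : 0 < ∫ r in (0 : ℝ)..δ, -(max (δ - r) 0 * ∑ j, b j * r ^ (-a j)) := by
    refine intervalIntegral.intervalIntegral_pos_of_pos_on (hii 0 δ).neg (fun r hr => ?_) hδ
    rw [neg_pos]
    exact mul_neg_of_pos_of_neg (lt_max_of_lt_left (sub_pos.2 hr.2)) (hneg r hr.1 hr.2)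
  rw [intervalIntegral.integral_neg] at h4
  linarith

/-! ### Coordinates on the hyperplane -/

theorem mem_onePerp {n : ℕ} (x : EuclideanSpace ℝ (Fin n)) : x ∈ onePerp n ↔ ∑ k, x k = 0 := by
  rw [Submodule.mem_orthogonal_singleton_iff_inner_right, PiLp.inner_apply]
  simp

/-- Points of the hyperplane are determined by all their coordinates but the first. -/
noncomputable def onePerpEquiv (N : ℕ) : onePerp (N + 1) ≃ₗ[ℝ] (Fin N → ℝ) where
  toFun x := fun i => (x : EuclideanSpace ℝ (Fin (N + 1))) i.succ
  map_add' _ _ := rfl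
  map_smul' _ _ := rfl
  invFun y := ⟨WithLp.toLp 2 (Fin.cons (-∑ i, y i) y), by
    rw [mem_onePerp, Fin.sum_univ_succ]
    simp⟩
  left_inv x := by
    have h := (mem_onePerp (x : EuclideanSpace ℝ (Fin (N + 1)))).1 x.2
    rw [Fin.sum_univ_succ] at h
    ext k
    refine Fin.cases ?_ (fun i => ?_) k
    · simp only [Fin.cons_zero]
      linarith
    · simp
  right_inv y := by
    ext i
    simp

theorem onePerpEquiv_symm_zero {N : ℕ} (y : Fin N → ℝ) :
    ((onePerpEquiv N).symm y : EuclideanSpace ℝ (Fin (N + 1))) 0 = -∑ i, y i := rfl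

theorem onePerpEquiv_symm_succ {N : ℕ} (y : Fin N → ℝ) (i : Fin N) :
    ((onePerpEquiv N).symm y : EuclideanSpace ℝ (Fin (N + 1))) i.succ = y i := rfl

theorem maxNorm_onePerpEquiv_symm {N : ℕ} (y : Fin N → ℝ) :
    maxNorm ((onePerpEquiv N).symm y) = liftNorm y := by
  refine le_antisymm ?_ ?_
  · refine (pi_norm_le_iff_of_nonneg (liftNorm_nonneg y)).2 fun k => ?_
    refine Fin.cases ?_ (fun i => ?_) k
    · rw [onePerpEquiv_symm_zero, norm_neg]
      exact le_max_right _ _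
    · rw [onePerpEquiv_symm_succ]
      exact (norm_le_pi_norm y i).trans (le_max_left _ _)
  · refine max_le ((pi_norm_le_iff_of_nonneg (norm_nonneg _)).2 fun i => ?_) ?_
    · rw [← onePerpEquiv_symm_succ y i]
      exact norm_le_pi_norm (WithLp.ofLp
        ((onePerpEquiv N).symm y : EuclideanSpace ℝ (Fin (N + 1)))) i.succ
    · rw [← abs_neg, ← onePerpEquiv_symm_zero y, ← Real.norm_eq_abs]
      exact norm_le_pi_norm (WithLp.ofLp
        ((onePerpEquiv N).symm y : EuclideanSpace ℝ (Fin (N + 1)))) 0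

theorem mem_polytope_iff {n : ℕ} (x : onePerp n) : x ∈ polytope n ↔ maxNorm x ≤ 1 := by
  rw [maxNorm, pi_norm_le_iff_of_nonneg zero_le_one]
  exact forall_congr' fun k => by rw [Real.norm_eq_abs, abs_le, Set.mem_Icc]

theorem continuous_maxNorm {n : ℕ} : Continuous (maxNorm (n := n)) := by
  unfold maxNorm
  fun_prop

theorem maxNorm_nonneg {n : ℕ} (x : onePerp n) : 0 ≤ maxNorm x := norm_nonneg _

theorem maxNorm_smul {n : ℕ} {r : ℝ} (hr : 0 ≤ r) (x : onePerp n) :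
    maxNorm (r • x) = r * maxNorm x := by
  rw [maxNorm, Submodule.coe_smul, WithLp.ofLp_smul, norm_smul, Real.norm_eq_abs, abs_of_nonneg hr,
    maxNorm]

theorem measurableSet_polytope (n : ℕ) : MeasurableSet (polytope n) := by
  have : polytope n = {x | maxNorm x ≤ 1} := Set.ext mem_polytope_iff
  rw [this]
  exact measurableSet_le continuous_maxNorm.measurable measurable_const

/-- Both sides come from Haar measures under linear isomorphisms, so uniqueness of Haar measure
applies. The constant is never computed: it enters both moments compared below in the same way. -/
theorem exists_map_perpVolume_eq (N : ℕ) : ∃ c : ℝ≥0∞,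
    (perpVolume (N + 1)).map (onePerpEquiv N) = c • (volume : Measure (Fin N → ℝ)) := by
  let e := (onePerpEquiv N).toContinuousLinearEquiv
  let e₀ := (stdOrthonormalBasis ℝ (onePerp (N + 1))).repr.symm.toContinuousLinearEquiv
  have h1 : (perpVolume (N + 1)).map (onePerpEquiv N) =
      (volume : Measure (EuclideanSpace ℝ (Fin (Module.finrank ℝ (onePerp (N + 1)))))).map
        (e₀.trans e) := by
    exact Measure.map_map e.continuous.measurable e₀.continuous.measurable
  have h2 := (e₀.trans e).isAddHaarMeasure_map
    (volume : Measure (EuclideanSpace ℝ (Fin (Module.finrank ℝ (onePerp (N + 1))))))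
  rw [h1]
  exact ⟨_, Measure.isAddLeftInvariant_eq_smul _ _⟩

theorem exists_lintegral_distribution {N : ℕ} {h : onePerp (N + 1) → ℝ≥0} {f : ℝ → ℝ≥0}
    (hf : Measurable f) (hh : ∀ x ∈ polytope (N + 1), h x = f (maxNorm x)) :
    ∃ c : ℝ≥0∞, ∀ Φ : onePerp (N + 1) → ℝ≥0∞, Measurable Φ →
      ∫⁻ x, Φ x ∂distribution (N + 1) h =
        c * ∫⁻ y in {y : Fin N → ℝ | liftNorm y ≤ 1},
          Φ ((onePerpEquiv N).symm y) * f (liftNorm y) := by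
  obtain ⟨c, hc⟩ := exists_map_perpVolume_eq N
  have hem : Measurable (onePerpEquiv N) :=
    (onePerpEquiv N).toContinuousLinearEquiv.continuous.measurable
  have hem' : Measurable (onePerpEquiv N).symm :=
    (onePerpEquiv N).toContinuousLinearEquiv.symm.continuous.measurable
  refine ⟨c, fun Φ hΦ => ?_⟩
  have hfm : Measurable fun x : onePerp (N + 1) => (f (maxNorm x) : ℝ≥0∞) :=
    (hf.comp continuous_maxNorm.measurable).coe_nnreal_ennreal
  have h1 : distribution (N + 1) h = ((perpVolume (N + 1)).restrict (polytope (N + 1))).withDensity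
      fun x => (f (maxNorm x) : ℝ≥0∞) := by
    refine withDensity_congr_ae ?_
    filter_upwards [ae_restrict_mem (measurableSet_polytope (N + 1))] with x hx
    rw [hh x hx]
  have hlm : Measurable fun y : Fin N → ℝ => Φ ((onePerpEquiv N).symm y) * f (liftNorm y) :=
    (hΦ.comp hem').mul (hf.comp continuous_liftNorm.measurable).coe_nnreal_ennreal
  rw [h1, lintegral_withDensity_eq_lintegral_mul _ hfm hΦ,
    ← lintegral_indicator (measurableSet_liftNorm_le 1), ← smul_eq_mul c, ← lintegral_smul_measure,
    ← hc, lintegral_map (hlm.indicator (measurableSet_liftNorm_le 1)) hem,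
    ← lintegral_indicator (measurableSet_polytope (N + 1))]
  refine lintegral_congr fun x => ?_
  have hx : liftNorm (onePerpEquiv N x) = maxNorm x := by
    rw [← maxNorm_onePerpEquiv_symm, LinearEquiv.symm_apply_apply]
  by_cases hmem : maxNorm x ≤ 1
  · rw [Set.indicator_of_mem ((mem_polytope_iff x).2 hmem),
      Set.indicator_of_mem (show onePerpEquiv N x ∈ {y | liftNorm y ≤ 1} from hx.trans_le hmem),
      LinearEquiv.symm_apply_apply, hx]
    exact mul_comm _ _
  · rw [Set.indicator_of_notMem fun h => hmem ((mem_polytope_iff x).1 h),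
      Set.indicator_of_notMem (show onePerpEquiv N x ∉ {y | liftNorm y ≤ 1} from
        fun h => hmem (hx.symm.trans_le h))]

/-! ### Moments of the maximum norm -/

theorem IsGerowRobsonDensity.exists_measurable_radial {N : ℕ} {h : onePerp (N + 2) → ℝ≥0}
    (hh : IsGerowRobsonDensity (N + 2) h) :
    ∃ f : ℝ → ℝ≥0, Measurable f ∧ ∀ x ∈ polytope (N + 2), h x = f (maxNorm x) := by
  obtain ⟨f, hf⟩ := hh.radial
  -- The given radial profile need not be measurable, so a new one is read off from `h` along the
  -- ray through v = (-1, 1, 0, …, 0). Clamping the radius to [0, 1] keeps the ray in the polytope,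
  -- outside of which nothing is known about `h`.
  let v : onePerp (N + 2) := (onePerpEquiv (N + 1)).symm (Pi.single 0 1)
  have hv : maxNorm v = 1 := by
    rw [maxNorm_onePerpEquiv_symm, liftNorm, Finset.sum_pi_single']
    simp [Pi.norm_single]
  have hmem : ∀ r : ℝ, (max 0 (min r 1)) • v ∈ polytope (N + 2) := fun r => by
    rw [mem_polytope_iff, maxNorm_smul (le_max_left _ _), hv, mul_one]
    exact max_le zero_le_one (min_le_right _ _)
  refine ⟨fun r => h ((max 0 (min r 1)) • v), ?_, fun x hx => ?_⟩
  · have hm : Measurable fun r : ℝ => (⟨(max 0 (min r 1)) • v, hmem r⟩ : polytope (N + 2)) :=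
      Measurable.subtype_mk (Continuous.measurable (by fun_prop))
    exact hh.measurable.comp hm
  · simp only
    rw [hf _ hx, hf _ (hmem _), maxNorm_smul (le_max_left _ _), hv, mul_one,
      min_eq_left ((mem_polytope_iff x).1 hx), max_eq_right (maxNorm_nonneg x)]

theorem lintegral_abs_pow_of_isUniform {Ω : Type*} [MeasurableSpace Ω] {P : Measure Ω} {X : Ω → ℝ}
    (hX : Measurable X) (hu : pdf.IsUniform X (Set.Icc (-1 : ℝ) 1) P volume) (k : ℕ) :
    ∫⁻ ω, ENNReal.ofReal (|X ω| ^ k) ∂P = ENNReal.ofReal (1 / (k + 1)) := by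
  have h1 : ∫⁻ ω, ENNReal.ofReal (|X ω| ^ k) ∂P = ∫⁻ x, ENNReal.ofReal (|x| ^ k) ∂(P.map X) :=
    (lintegral_map (f := fun x => ENNReal.ofReal (|x| ^ k)) (by fun_prop) hX).symm
  have hii : ∀ x y : ℝ, IntervalIntegrable (fun u : ℝ => |u| ^ k) volume x y :=
    fun x y => Continuous.intervalIntegrable (by fun_prop) _ _
  have h3 : ∫ u in (-1 : ℝ)..1, |u| ^ k = 2 * (1 / (k + 1)) := by
    have e1 := intervalIntegral.integral_comp_neg (a := 0) (b := 1) (fun u : ℝ => |u| ^ k)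
    simp only [abs_neg, neg_zero] at e1
    have e2 : ∫ u in (0 : ℝ)..1, |u| ^ k = 1 / (k + 1) := by
      rw [intervalIntegral.integral_congr (g := fun u : ℝ => u ^ k) fun u hu => by
        rw [Set.uIcc_of_le zero_le_one] at hu
        simp only [abs_of_nonneg hu.1], integral_pow]
      simp
    rw [← intervalIntegral.integral_add_adjacent_intervals (hii (-1) 0) (hii 0 1), ← e1, e2]
    ring
  rw [h1, hu, ProbabilityTheory.cond, lintegral_smul_measure, ← ofReal_integral_eq_lintegral_ofReal,
    integral_Icc_eq_integral_Ioc, ← intervalIntegral.integral_of_le (by norm_num), h3,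
    Real.volume_Icc, smul_eq_mul, ← ENNReal.ofReal_inv_of_pos (by norm_num),
    ← ENNReal.ofReal_mul (by norm_num)]
  · congr 1
    ring
  · rw [← IntegrableOn, integrableOn_Icc_iff_integrableOn_Ioc]
    exact (intervalIntegrable_iff_integrableOn_Ioc_of_le (by norm_num)).1 (hii _ _)
  · exact Filter.Eventually.of_forall fun u => by positivity

/-- The moments of the maximum norm under a Gerow–Robson density that gives a random balanced
sample. -/
theorem lintegral_maxNorm_pow {M : ℕ} {h : onePerp (M + 4) → ℝ≥0}
    (hh : IsGerowRobsonDensity (M + 4) h) (hb : GivesRandomBalancedSample (M + 4) h) (k : ℕ) :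
    (∫⁻ x, ENNReal.ofReal (maxNorm x ^ k) ∂distribution (M + 4) h) *
        ENNReal.ofReal (((M : ℝ) + 3 + k) * ∫ x in (0 : ℝ)..1, x ^ k * truncSum (M + 3) x) =
      ENNReal.ofReal (((M : ℝ) + 3) * (∫ x in (0 : ℝ)..1, truncSum (M + 3) x) / (k + 1)) := by
  obtain ⟨f, hfm, hf⟩ := hh.exists_measurable_radial
  obtain ⟨c, hc⟩ := exists_lintegral_distribution hfm hf
  have hI : ∀ k : ℕ, 0 ≤ ∫ x in (0 : ℝ)..1, x ^ k * truncSum (M + 3) x := fun k =>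
    intervalIntegral.integral_nonneg zero_le_one fun x hx =>
      mul_nonneg (pow_nonneg hx.1 _) (truncSum_nonneg _ _)
  have hX : Measurable fun x : onePerp (M + 4) => (x : EuclideanSpace ℝ (Fin (M + 4))) 0 :=
    Continuous.measurable (by fun_prop)
  have hN : Measurable fun x : onePerp (M + 4) => maxNorm x := continuous_maxNorm.measurable
  have hg : Measurable fun r : ℝ => (f r : ℝ≥0∞) := hfm.coe_nnreal_ennreal
  -- the moment of a coordinate
  have h1 : ENNReal.ofReal (1 / (k + 1)) =
      c * ((ENNReal.ofReal (2 / (M + 2).factorial) *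
        ENNReal.ofReal (∫ x in (0 : ℝ)..1, x ^ k * truncSum (M + 3) x)) *
        ∫⁻ r in Set.Ioc (0 : ℝ) 1, ENNReal.ofReal (((M + 2 + k : ℕ) + 1) * r ^ (M + 2 + k)) *
          f r) := by
    rw [← lintegral_abs_pow_of_isUniform hX (hb.2 0) k, hc _ (by fun_prop),
      ← setLIntegral_abs_sum_pow (M + 1) k, ← setLIntegral_mul_comp_liftNorm (M + 2) k hg]
    simp only [onePerpEquiv_symm_zero, abs_neg]
  -- the moment of the maximum norm
  have h2 : ∫⁻ x, ENNReal.ofReal (maxNorm x ^ k) ∂distribution (M + 4) h =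
      c * ((ENNReal.ofReal (2 / (M + 2).factorial) *
        ENNReal.ofReal (∫ x in (0 : ℝ)..1, truncSum (M + 3) x)) *
        ∫⁻ r in Set.Ioc (0 : ℝ) 1, ENNReal.ofReal ((((M + 2 : ℕ) : ℝ) + 1) * r ^ (M + 2)) *
          (ENNReal.ofReal (r ^ k) * f r)) := by
    have e1 := setLIntegral_abs_sum_pow (M + 1) 0
    have e2 := setLIntegral_mul_comp_liftNorm (M + 2) 0
      (g := fun r => ENNReal.ofReal (r ^ k) * f r) (by fun_prop)
    simp only [pow_zero, one_mul, ENNReal.ofReal_one, add_zero] at e1 e2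
    rw [hc _ (by fun_prop), ← e1, ← e2]
    simp only [maxNorm_onePerpEquiv_symm]
  -- The unknown profile enters both moments only through this integral, with factors n-1+k and n-1
  -- (n = M+4). Cross-multiplication then matches the two sides without dividing in `ℝ≥0∞`.
  set J := ∫⁻ r in Set.Ioc (0 : ℝ) 1, ENNReal.ofReal (r ^ (M + 2 + k)) * f r with hJ
  have h3 : ∫⁻ r in Set.Ioc (0 : ℝ) 1, ENNReal.ofReal (((M + 2 + k : ℕ) + 1) * r ^ (M + 2 + k)) *
      f r = ENNReal.ofReal ((M : ℝ) + 3 + k) * J := by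
    rw [hJ, ← lintegral_const_mul _ (by fun_prop)]
    refine lintegral_congr fun r => ?_
    rw [ENNReal.ofReal_mul (by positivity), mul_assoc]
    congr 2
    push_cast
    ring
  have h4 : ∫⁻ r in Set.Ioc (0 : ℝ) 1, ENNReal.ofReal ((((M + 2 : ℕ) : ℝ) + 1) * r ^ (M + 2)) *
      (ENNReal.ofReal (r ^ k) * f r) = ENNReal.ofReal ((M : ℝ) + 3) * J := by
    rw [hJ, ← lintegral_const_mul _ (by fun_prop)]
    refine setLIntegral_congr_fun measurableSet_Ioc fun r hr => ?_
    have hr0 := hr.1.le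
    rw [← mul_assoc, ← mul_assoc, ← ENNReal.ofReal_mul (by positivity),
      ← ENNReal.ofReal_mul (by positivity)]
    congr 2
    push_cast
    ring
  rw [h3] at h1
  rw [h4] at h2
  have h5 : ENNReal.ofReal (((M : ℝ) + 3) * (∫ x in (0 : ℝ)..1, truncSum (M + 3) x) / (k + 1)) =
      ENNReal.ofReal ((M : ℝ) + 3) * (ENNReal.ofReal (∫ x in (0 : ℝ)..1, truncSum (M + 3) x) *
        ENNReal.ofReal (1 / (k + 1))) := by
    have hI0 : 0 ≤ ∫ x in (0 : ℝ)..1, truncSum (M + 3) x := by simpa using hI 0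
    rw [← ENNReal.ofReal_mul hI0, ← ENNReal.ofReal_mul (by positivity), mul_one_div, mul_div_assoc]
  rw [h2, h5, h1, ENNReal.ofReal_mul (by positivity)]
  ring

/-- For k = 0 the weighted volume formula makes this integral proportional to the volume of the unit
ball, which contains a nonempty open set. -/
theorem integral_truncSum_ne_zero (m : ℕ) : ∫ x in (0 : ℝ)..1, truncSum (m + 2) x ≠ 0 := by
  intro h0
  have h1 := setLIntegral_abs_sum_pow m 0
  simp only [pow_zero, one_mul, h0, ENNReal.ofReal_zero, mul_zero, ENNReal.ofReal_one,
    setLIntegral_one] at h1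
  have hopen : IsOpen {y : Fin (m + 2) → ℝ | liftNorm y < 1} :=
    isOpen_lt continuous_liftNorm continuous_const
  have h2 := hopen.measure_pos volume ⟨0, by simp [liftNorm]⟩
  exact h2.ne' (measure_mono_null (fun y (hy : liftNorm y < 1) => hy.le) h1)

theorem IsGerowRobsonDensity.isProbabilityMeasure {n : ℕ} {h : onePerp n → ℝ≥0}
    (hh : IsGerowRobsonDensity n h) : IsProbabilityMeasure (distribution n h) := by
  refine ⟨?_⟩
  rw [distribution, withDensity_apply _ MeasurableSet.univ, Measure.restrict_univ]
  exact hh.lintegral_eq_one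

theorem ae_distribution_mem_polytope {n : ℕ} (h : onePerp n → ℝ≥0) :
    ∀ᵐ x ∂distribution n h, x ∈ polytope n :=
  (withDensity_absolutelyContinuous _ _).ae_le (ae_restrict_mem (measurableSet_polytope n))

theorem integral_maxNorm_pow {M : ℕ} {h : onePerp (M + 4) → ℝ≥0}
    (hh : IsGerowRobsonDensity (M + 4) h) (hb : GivesRandomBalancedSample (M + 4) h) (k : ℕ) :
    ∫ x, maxNorm x ^ k ∂distribution (M + 4) h =
      (((M + 4 : ℕ) : ℝ) * ∏ j ∈ Finset.Icc 1 (alpha (M + 4)), ((k : ℝ) + 1 + 2 * (j : ℝ))) /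
        (B (M + 4)).eval ((k : ℝ) + 1) := by
  have := hh.isProbabilityMeasure
  have hcont : Continuous fun x : onePerp (M + 4) => maxNorm x ^ k := continuous_maxNorm.pow k
  have hint : Integrable (fun x => maxNorm x ^ k) (distribution (M + 4) h) := by
    refine Integrable.of_bound hcont.aestronglyMeasurable 1 ?_
    filter_upwards [ae_distribution_mem_polytope h] with x hx
    rw [norm_pow, Real.norm_eq_abs, abs_of_nonneg (maxNorm_nonneg x)]
    exact pow_le_one₀ (maxNorm_nonneg x) ((mem_polytope_iff x).1 hx)
  have hnn : ∀ x : onePerp (M + 4), 0 ≤ maxNorm x ^ k := fun x => pow_nonneg (maxNorm_nonneg x) k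
  have hI : ∀ k : ℕ, 0 ≤ ∫ x in (0 : ℝ)..1, x ^ k * truncSum (M + 3) x := fun k =>
    intervalIntegral.integral_nonneg zero_le_one fun x hx =>
      mul_nonneg (pow_nonneg hx.1 _) (truncSum_nonneg _ _)
  have hI0 : 0 ≤ ∫ x in (0 : ℝ)..1, truncSum (M + 3) x := by simpa using hI 0
  have h0 : ∫ x in (0 : ℝ)..1, truncSum (M + 3) x ≠ 0 := integral_truncSum_ne_zero (M + 1)
  have h1 := lintegral_maxNorm_pow hh hb k
  rw [← ofReal_integral_eq_lintegral_ofReal hint (Filter.Eventually.of_forall hnn),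
    ← ENNReal.ofReal_mul (integral_nonneg hnn), ENNReal.ofReal_eq_ofReal_iff
      (mul_nonneg (integral_nonneg hnn) (mul_nonneg (by positivity) (hI k))) (by positivity)] at h1
  have h2 := integral_pow_mul_truncSum_mul M k h0
  have hB := eval_B_pos M (t := (k : ℝ) + 1) (by positivity)
  -- The factor for j = 0 is k+1; it cancels the moment 1/(k+1) of a coordinate, which is why the
  -- numerator runs over j ≥ 1 only.
  have hprod : ∏ j ∈ Finset.range (alpha (M + 4) + 1), ((k : ℝ) + 1 + 2 * (j : ℝ)) =
      ((k : ℝ) + 1) * ∏ j ∈ Finset.Icc 1 (alpha (M + 4)), ((k : ℝ) + 1 + 2 * (j : ℝ)) := by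
    rw [Finset.range_eq_Ico, Finset.prod_eq_prod_Ico_succ_bot (Nat.succ_pos _),
      show Finset.Ico (0 + 1) (alpha (M + 4) + 1) = Finset.Icc 1 (alpha (M + 4)) by
        ext; simp]
    simp only [Nat.cast_zero, mul_zero, add_zero]
  rw [eq_div_iff hB.ne']
  rw [hprod] at h2
  have h3 : ((M : ℝ) + 3) * (∫ x in (0 : ℝ)..1, truncSum (M + 3) x) ≠ 0 :=
    mul_ne_zero (by positivity) h0
  refine mul_left_cancel₀ h3 ?_
  rw [eq_div_iff (by positivity)] at h1
  push_cast
  linear_combination (-(∫ x, maxNorm x ^ k ∂distribution (M + 4) h)) * h2 +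
    (((M : ℝ) + 4) * ∏ j ∈ Finset.Icc 1 (alpha (M + 4)), ((k : ℝ) + 1 + 2 * (j : ℝ))) * h1

end RBS

/-! ### The contradiction -/

/-- Let `n ≥ 6`, let `a 0 > a 1 > ⋯ > a α_n` be roots of `B_n`, and let `b` be the coefficients
of the partial fraction decomposition of `n ∏_{j=1}^{α_n} (s + 2j) / B_n(s)`. If `b 0 < 0`, no
Gerow–Robson density on `M(n)` gives a random balanced sample. -/
theorem theorem3p4 (n : ℕ) (hn : 6 ≤ n) (a b : Fin (RBS.alpha n + 1) → ℝ)
    (ha : StrictAnti a) (hroot : ∀ j, (RBS.B n).IsRoot (a j))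
    (hb : ∀ s : ℝ, (∀ j, s ≠ a j) →
      ((n : ℝ) * ∏ j ∈ Finset.Icc 1 (RBS.alpha n), (s + 2 * (j : ℝ))) / (RBS.B n).eval s =
        ∑ j, b j / (s - a j))
    (hb0 : b 0 < 0) :
    ¬ ∃ h : RBS.onePerp n → ℝ≥0,
      RBS.IsGerowRobsonDensity n h ∧ RBS.GivesRandomBalancedSample n h := by
  rintro ⟨h, hh, hs⟩
  obtain ⟨M, rfl⟩ : ∃ M, n = M + 4 := ⟨n - 4, by omega⟩
  have ha0 : ∀ j, a j ≤ 0 := fun j => by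
    by_contra hj
    exact (RBS.eval_B_pos M (not_le.1 hj)).ne' (hroot j)
  have := hh.isProbabilityMeasure
  have hN : Measurable (RBS.maxNorm (n := M + 4)) := RBS.continuous_maxNorm.measurable
  have : IsProbabilityMeasure ((RBS.distribution (M + 4) h).map RBS.maxNorm) :=
    Measure.isProbabilityMeasure_map hN.aemeasurable
  refine RBS.false_of_moments_eq (ρ := (RBS.distribution (M + 4) h).map RBS.maxNorm) ?_ ha ha0 hb0
    fun k => ?_
  · refine (ae_map_iff hN.aemeasurable (p := fun r => r ∈ Set.Icc (0 : ℝ) 1) measurableSet_Icc).2 ?_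
    filter_upwards [RBS.ae_distribution_mem_polytope h] with x hx
    exact ⟨RBS.maxNorm_nonneg x, (RBS.mem_polytope_iff x).1 hx⟩
  · rw [integral_map hN.aemeasurable (continuous_pow k).aestronglyMeasurable,
      RBS.integral_maxNorm_pow hh hs k]
    -- The decomposition is used at s = k+1, which is positive and hence distinct from every a j.
    refine hb _ fun j => ?_
    have : (0 : ℝ) ≤ k := k.cast_nonneg
    linarith [ha0 j]
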